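/- Let $G$ be a connected, simply connected nilpotent (real, finite-dimensional) Lie group with Lie algebra $\mathfrak g$, let $\Gamma\subset G$ be a discrete cocompact subgroup, and let $A:G\to G$ be a Lie group automorphism with $A(\Gamma)=\Gamma$ whose differential $dA:\mathfrak g\to\mathfrak g$ is hyperbolic, i.e. has no (complex) eigenvalue of modulus one. Let $\mathfrak g^{s}$ and $\mathfrak g^{u}$ be the sums of the generalized eigenspaces of $dA$ for the eigenvalues of modulus smaller, respectively larger, than one. Suppose that there are $dA$-invariant splittings $\mathfrak g^{s}=\mathfrak g^{ss}\oplus\mathfrak g^{ws}$ and $\mathfrak g^{u}=\mathfrak g^{wu}\oplus\mathfrak g^{uu}$ such that $\mathfrak g=\mathfrak g^{ss}\oplus\mathfrak g^{ws}\oplus\mathfrak g^{wu}\oplus\mathfrak g^{uu}$ is dominated: for any two consecutive summands $V,W$ (in this order) there are a norm on $\mathfrak g$ and constants $C>0$, $0<\lambda<1$ with $\|dA^n v\|\le C\lambda^n\|dA^n w\|$ for all unit vectors $v\in V$, $w\in W$ and all $n\ge 0$. Put $\mathfrak g^{c}=\mathfrak g^{ws}\oplus\mathfrak g^{wu}$,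 $\mathfrak g^{cs}=\mathfrak g^{ss}\oplus\mathfrak g^{c}$, $\mathfrak g^{cu}=\mathfrak g^{c}\oplus\mathfrak g^{uu}$, and assume that $\mathfrak g^{cs}$ and $\mathfrak g^{cu}$ (hence also $\mathfrak g^{c}=\mathfrak g^{cs}\cap\mathfrak g^{cu}$) are Lie subalgebras of $\mathfrak g$. For $\sigma\in\{s,u,ss,uu,c,cs,cu\}$ let $G^{\sigma}\subset G$ be the connected Lie subgroup with Lie algebra $\mathfrak g^{\sigma}$, i.e. the subgroup generated by $\exp(\mathfrak g^{\sigma})$, and for $x\in G$ let $\tilde{\mathcal W}^{\sigma}(x)=xG^{\sigma}$ be the leaf through $x$ of the corresponding foliation of $G$. Then: 1. for all $x,y\in G$ the leaves $\tilde{\mathcal W}^{cs}(x)$ and $\tilde{\mathcal W}^{uu}(y)$ intersect in exactly one point; 2. for all $x,y\in G$ the leaves $\tilde{\mathcal W}^{cu}(x)$ and $\tilde{\mathcal W}^{ss}(y)$ intersect in exactly one point; 3. the leaves of $\tilde{\mathcal W}^{c}$ and of $\tilde{\mathcal W}^{uu}$ are contained in leaves of $\tilde{\mathcal W}^{cu}$,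 and for all $x,y$ in the same leaf of $\tilde{\mathcal W}^{cu}$ the leaves $\tilde{\mathcal W}^{c}(x)$ and $\tilde{\mathcal W}^{uu}(y)$ intersect in exactly one point; 4. the leaves of $\tilde{\mathcal W}^{c}$ and of $\tilde{\mathcal W}^{ss}$ are contained in leaves of $\tilde{\mathcal W}^{cs}$, and for all $x,y$ in the same leaf of $\tilde{\mathcal W}^{cs}$ the leaves $\tilde{\mathcal W}^{c}(x)$ and $\tilde{\mathcal W}^{ss}(y)$ intersect in exactly one point; 5. for all $x,y\in G$ the leaves $\tilde{\mathcal W}^{s}(x)$ and $\tilde{\mathcal W}^{u}(y)$ intersect in exactly one point. -/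

import Mathlib

open scoped Manifold ContDiff TensorProduct

noncomputable section

namespace NilAnosov

section LinearAlgebra

variable {V : Type*} [AddCommGroup V] [Module ℝ V]

/-- The real endomorphism `T` is hyperbolic: its complexification has no eigenvalue of modulus
one. -/
def IsHyperbolic (T : Module.End ℝ V) : Prop :=
  ∀ z : ℂ, Module.End.HasEigenvalue (T.baseChange ℂ : Module.End ℂ (ℂ ⊗[ℝ] V)) z → ‖z‖ ≠ 1

/-- The real subspace of the vectors `v` whose complexification `1 ⊗ v` lies in the sum of the
(generalized) eigenspaces of `T` for the complex eigenvalues with modulus in `S`. -/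
def spectralSubspace (T : Module.End ℝ V) (S : Set ℝ) : Submodule ℝ V :=
  Submodule.comap (TensorProduct.mk ℝ ℂ V 1)
    (Submodule.restrictScalars ℝ
      (⨆ z : {z : ℂ // ‖z‖ ∈ S},
        Module.End.maxGenEigenspace (T.baseChange ℂ : Module.End ℂ (ℂ ⊗[ℝ] V)) z.1))

/-- The stable subspace: eigenvalues of modulus smaller than one. -/
def stableSubspace (T : Module.End ℝ V) : Submodule ℝ V := spectralSubspace T (Set.Iio 1)

/-- The unstable subspace: eigenvalues of modulus larger than one. -/
def unstableSubspace (T : Module.End ℝ V) : Submodule ℝ V := spectralSubspace T (Set.Ioi 1)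

/-- `W₁` is dominated by `W₂` under `T`: for some norm `N` on `V` and constants `C > 0`,
`0 < r < 1`, all unit vectors `v ∈ W₁`, `w ∈ W₂` and all `n ≥ 0` satisfy
`N (T ^ n v) ≤ C * r ^ n * N (T ^ n w)` (written here in homogeneous form). -/
def IsDominatedBy (T : Module.End ℝ V) (W₁ W₂ : Submodule ℝ V) : Prop :=
  ∃ N : Seminorm ℝ V, (∀ v, N v = 0 → v = 0) ∧
    ∃ C : ℝ, 0 < C ∧ ∃ r : ℝ, 0 < r ∧ r < 1 ∧
      ∀ n : ℕ, ∀ v ∈ W₁, ∀ w ∈ W₂,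
        N ((T ^ n) v) * N w ≤ C * r ^ n * (N v * N ((T ^ n) w))

/-- A dominated splitting `V = V^ss ⊕ V^ws ⊕ V^wu ⊕ V^uu` into `T`-invariant subspaces refining the
stable and the unstable subspace: `V^s = V^ss ⊕ V^ws` and `V^u = V^wu ⊕ V^uu`. Some of the
subspaces may be zero. -/
structure DominatedSplitting (T : Module.End ℝ V) where
  /-- The strong stable subspace. -/
  ss : Submodule ℝ V
  /-- The weak stable subspace. -/
  ws : Submodule ℝ V
  /-- The weak unstable subspace. -/
  wu : Submodule ℝ V
  /-- The strong unstable subspace. -/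
  uu : Submodule ℝ V
  map_ss : ∀ v ∈ ss, T v ∈ ss
  map_ws : ∀ v ∈ ws, T v ∈ ws
  map_wu : ∀ v ∈ wu, T v ∈ wu
  map_uu : ∀ v ∈ uu, T v ∈ uu
  sup_stable : ss ⊔ ws = stableSubspace T
  disjoint_stable : Disjoint ss ws
  sup_unstable : wu ⊔ uu = unstableSubspace T
  disjoint_unstable : Disjoint wu uu
  dominated_ss_ws : IsDominatedBy T ss ws
  dominated_ws_wu : IsDominatedBy T ws wu
  dominated_wu_uu : IsDominatedBy T wu uu

namespace DominatedSplitting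

variable {T : Module.End ℝ V} (D : DominatedSplitting T)

/-- The stable subspace `V^ss ⊕ V^ws`. -/
def s : Submodule ℝ V := D.ss ⊔ D.ws

/-- The unstable subspace `V^wu ⊕ V^uu`. -/
def u : Submodule ℝ V := D.wu ⊔ D.uu

/-- The center subspace `V^ws ⊕ V^wu`. -/
def c : Submodule ℝ V := D.ws ⊔ D.wu

/-- The center-stable subspace `V^ss ⊕ V^c`. -/
def cs : Submodule ℝ V := D.ss ⊔ D.c

/-- The center-unstable subspace `V^c ⊕ V^uu`. -/
def cu : Submodule ℝ V := D.c ⊔ D.uu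

end DominatedSplitting

end LinearAlgebra

section LieGroups

variable {E : Type*} [NormedAddCommGroup E] [NormedSpace ℝ E]
  {G : Type*} [TopologicalSpace G] [ChartedSpace E G] [Group G]

/-- The differential at the identity of an automorphism `A` of `G`, as an endomorphism of the Lie
algebra `T_1 G`. Since `A 1 = 1`, the tangent space at `A 1` is the tangent space at `1` (both are
the model space `E`, through the same preferred chart). -/
def lieDifferential (A : G ≃* G) : Module.End ℝ (GroupLieAlgebra 𝓘(ℝ, E) G) where
  toFun v := mfderiv 𝓘(ℝ, E) 𝓘(ℝ, E) A (1 : G) v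
  map_add' v w := map_add (mfderiv 𝓘(ℝ, E) 𝓘(ℝ, E) A (1 : G)) v w
  map_smul' a v := map_smul (mfderiv 𝓘(ℝ, E) 𝓘(ℝ, E) A (1 : G)) a v

/-- A subspace of the Lie algebra of `G` is a Lie subalgebra: it is closed under the bracket. -/
def IsLieSubalgebra (W : Submodule ℝ (GroupLieAlgebra 𝓘(ℝ, E) G)) : Prop :=
  ∀ v ∈ W, ∀ w ∈ W, ⁅v, w⁆ ∈ W

/-- `IsExp v g` says that `g = exp v`: the integral curve through the identity of the left-invariant
vector field with value `v` at the identity is at `g` at time one. -/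
def IsExp (v : GroupLieAlgebra 𝓘(ℝ, E) G) (g : G) : Prop :=
  ∃ γ : ℝ → G, IsMIntegralCurve (I := 𝓘(ℝ, E)) γ (mulInvariantVectorField v) ∧ γ 0 = 1 ∧ γ 1 = g

/-- The connected Lie subgroup of `G` with Lie algebra `W` (for a Lie subalgebra `W`): the subgroup
generated by the exponentials of the elements of `W`. -/
def integralSubgroup (W : Submodule ℝ (GroupLieAlgebra 𝓘(ℝ, E) G)) : Subgroup G :=
  Subgroup.closure {g : G | ∃ v ∈ W, IsExp v g}

/-- The leaf through `x` of the algebraic foliation of `G` given by `W`: the left translate by `x`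
of the connected Lie subgroup with Lie algebra `W`. -/
def leaf (W : Submodule ℝ (GroupLieAlgebra 𝓘(ℝ, E) G)) (x : G) : Set G :=
  (fun g : G => x * g) '' (integralSubgroup W : Set G)

end LieGroups

section ProductStructure

variable {G : Type*}

/-- Global product structure of two foliations, given by the leaves `F₁ x`, `F₂ y` of their lifts to
`G`: for all `x` and `y`, the leaves `F₁ x` and `F₂ y` meet in exactly one point. -/
def HasGPS (F₁ F₂ : G → Set G) : Prop :=
  ∀ x y : G, ∃! p : G, p ∈ F₁ x ∩ F₂ y

/-- Global product structure of `F₁` and `F₂` inside the foliation `F`: the leaves of `F₁` and `F₂`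
are contained in leaves of `F`, and for all `x` and `y` in the same leaf of `F`, the leaves `F₁ x`
and `F₂ y` meet in exactly one point. -/
def HasGPSInside (F F₁ F₂ : G → Set G) : Prop :=
  (∀ x : G, F₁ x ⊆ F x) ∧ (∀ x : G, F₂ x ⊆ F x) ∧
    ∀ x y : G, y ∈ F x → ∃! p : G, p ∈ F₁ x ∩ F₂ y

end ProductStructure

end NilAnosov

end

set_option linter.unusedSectionVars false

/-! The leaves `x H` and `y K` of two subgroups meet in exactly one point as soon as `x⁻¹ * y` lies
in `H * K` and `H ∩ K = 1` (`existsUnique_mem_cosets`). So the theorem reduces to a factorization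
statement: if `h`, `k` and `h ⊕ k` are subalgebras of a nilpotent Lie algebra, then every element of
the subgroup of `h ⊕ k` is a product from the subgroups of `h` and `k`, and these meet trivially
when `h ⊕ k` is the whole algebra and `G` is simply connected.

Factorization comes from coordinates of the second kind (`IsCoordinates`). By nilpotency, a flag
from `h` to `h ⊕ k` can be built by adding vectors `X ∈ k`, each normalizing the subspace reached so
far (`exists_notMem_normalizing`), and the coordinates grow by `(v, t) ↦ Φ v * exp (t X)`. Curves
tangent to the subspace lift through `Φ`, because their `X`-component can be integrated and divided
off; hence `Φ` maps onto the subgroup. When the flag reaches the whole algebra, `Φ` is a local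
homeomorphism that lifts all paths, so it is injective by monodromy (`IsCoordinates.injective`).
Coordinates adapted to `h` and `k` then give `H ∩ K = 1` (`eq_one_of_mem_expSubgroup`).

It remains to see which subspaces are subalgebras. The stable space consists of the vectors
contracted by `dA`, the unstable one of those contracted by its inverse; since `dA` preserves the
bracket, both are subalgebras. A bracket of two strong stable vectors is stable, and its weak
component must vanish, since it would dominate the contraction of the bracket
(`bilin_mem_of_norm_dominated`); the strong unstable case is the same for the inverse. The center is
the intersection of `cs` and `cu`. -/

noncomputable section

namespace NilAnosov

open Filter Topology Set

/-! ### Calculus in the chart at the identity and left logarithmic derivatives. -/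

section LocalGroup

variable {E : Type*} [NormedAddCommGroup E] [NormedSpace ℝ E]
  {G : Type*} [TopologicalSpace G] [ChartedSpace E G] [Group G]
  {V : Type*} [NormedAddCommGroup V] [NormedSpace ℝ V]

/-- The preferred chart of `G` at the identity, as a map. -/
def toChart (g : G) : E := chartAt E (1 : G) g

/-- The inverse of the preferred chart of `G` at the identity. -/
def ofChart (x : E) : G := (chartAt E (1 : G)).symm x

variable (E G) in
/-- The coordinates of the identity. -/
def origin : E := toChart (1 : G)

@[simp] lemma toChart_one : toChart (1 : G) = origin E G := rfl

@[simp] lemma ofChart_origin : ofChart (origin E G) = (1 : G) :=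
  (chartAt E (1 : G)).left_inv (mem_chart_source E (1 : G))

lemma eventually_toChart_ofChart : ∀ᶠ x in 𝓝 (origin E G), toChart (ofChart x : G) = x :=
  (chartAt E (1 : G)).eventually_right_inverse' (mem_chart_source E (1 : G))

lemma eventually_ofChart_toChart : ∀ᶠ g in 𝓝 (1 : G), ofChart (toChart g : E) = g :=
  (chartAt E (1 : G)).eventually_left_inverse (mem_chart_source E (1 : G))

lemma eventually_continuousAt_toChart :
    ∀ᶠ g in 𝓝 (1 : G), ContinuousAt (toChart : G → E) g := by
  filter_upwards [(chartAt E (1 : G)).open_source.mem_nhds (mem_chart_source E (1 : G))] with g hg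
  exact (chartAt E (1 : G)).continuousAt hg

lemma continuousAt_toChart_one : ContinuousAt (toChart : G → E) 1 :=
  eventually_continuousAt_toChart.self_of_nhds

lemma continuousAt_ofChart_origin : ContinuousAt (ofChart : E → G) (origin E G) :=
  (chartAt E (1 : G)).continuousAt_symm (mem_chart_target E (1 : G))

lemma tendsto_ofChart : Tendsto (ofChart : E → G) (𝓝 (origin E G)) (𝓝 1) := by
  simpa [ContinuousAt] using (continuousAt_ofChart_origin (E := E) (G := G))

lemma tendsto_toChart : Tendsto (toChart : G → E) (𝓝 1) (𝓝 (origin E G)) :=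
  continuousAt_toChart_one

variable [LieGroup 𝓘(ℝ, E) ∞ G]

lemma contMDiffAt_ofChart : ContMDiffAt 𝓘(ℝ, E) 𝓘(ℝ, E) ∞ (ofChart : E → G) (origin E G) :=
  (contMDiffOn_chart_symm (I := 𝓘(ℝ, E)) (x := (1 : G))).contMDiffAt
    ((chartAt E (1 : G)).open_target.mem_nhds (mem_chart_target E (1 : G)))

lemma contMDiffAt_toChart : ContMDiffAt 𝓘(ℝ, E) 𝓘(ℝ, E) ∞ (toChart : G → E) (1 : G) :=
  (contMDiffOn_chart (I := 𝓘(ℝ, E)) (x := (1 : G))).contMDiffAt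
    ((chartAt E (1 : G)).open_source.mem_nhds (mem_chart_source E (1 : G)))

lemma contDiffAt_toChart_comp {F : V → G} {x : V} (hF : ContMDiffAt 𝓘(ℝ, V) 𝓘(ℝ, E) ∞ F x)
    (hx : F x = 1) : ContDiffAt ℝ ∞ (fun y => (toChart (F y) : E)) x := by
  rw [← contMDiffAt_iff_contDiffAt]
  refine ContMDiffAt.comp x (g := toChart) ?_ hF
  rw [hx]
  exact contMDiffAt_toChart

lemma contMDiffAt_ofChart_fst : ContMDiffAt 𝓘(ℝ, E × E) 𝓘(ℝ, E) ∞
    (fun p : E × E => (ofChart p.1 : G)) (origin E G, origin E G) :=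
  ContMDiffAt.comp (origin E G, origin E G) (g := (ofChart : E → G)) (f := Prod.fst)
    contMDiffAt_ofChart contDiff_fst.contMDiff.contMDiffAt

lemma contMDiffAt_ofChart_snd : ContMDiffAt 𝓘(ℝ, E × E) 𝓘(ℝ, E) ∞
    (fun p : E × E => (ofChart p.2 : G)) (origin E G, origin E G) :=
  ContMDiffAt.comp (origin E G, origin E G) (g := (ofChart : E → G)) (f := Prod.snd)
    contMDiffAt_ofChart contDiff_snd.contMDiff.contMDiffAt

variable (E G) in
/-- Multiplication in the chart at the identity. -/
def chartMul (p : E × E) : E := toChart (ofChart p.1 * ofChart p.2 : G)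

variable (E G) in
/-- Conjugation in the chart at the identity. -/
def chartConj (p : E × E) : E := toChart (ofChart p.1 * ofChart p.2 * (ofChart p.1)⁻¹ : G)

lemma contDiffAt_chartMul : ContDiffAt ℝ ∞ (chartMul E G) (origin E G, origin E G) :=
  contDiffAt_toChart_comp (contMDiffAt_ofChart_fst.mul contMDiffAt_ofChart_snd) (by simp)

lemma contDiffAt_chartConj : ContDiffAt ℝ ∞ (chartConj E G) (origin E G, origin E G) :=
  contDiffAt_toChart_comp ((contMDiffAt_ofChart_fst.mul contMDiffAt_ofChart_snd).mul
    contMDiffAt_ofChart_fst.inv) (by simp)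

/-- The derivative at the identity, in the chart, of a map fixing the identity. -/
def chartDeriv (f : G → G) : E →L[ℝ] E :=
  fderiv ℝ (fun x => toChart (f (ofChart x : G))) (origin E G)

lemma hasStrictFDerivAt_chartDeriv {f : G → G} (hf : ContMDiffAt 𝓘(ℝ, E) 𝓘(ℝ, E) ∞ f 1)
    (h1 : f 1 = 1) : HasStrictFDerivAt (fun x => (toChart (f (ofChart x : G)) : E))
      (chartDeriv f) (origin E G) := by
  have : ContDiffAt ℝ ∞ (fun x => (toChart (f (ofChart x : G)) : E)) (origin E G) := by
    refine contDiffAt_toChart_comp (ContMDiffAt.comp (origin E G) (g := f) ?_ contMDiffAt_ofChart)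
      (by simp [h1])
    rw [ofChart_origin]; exact hf
  exact this.hasStrictFDerivAt (by simp)

lemma chartDeriv_id : (chartDeriv (id : G → G) : E →L[ℝ] E) = ContinuousLinearMap.id ℝ E := by
  refine (HasFDerivAt.congr_of_eventuallyEq (hasFDerivAt_id (𝕜 := ℝ) _) ?_).fderiv
  exact eventually_toChart_ofChart

lemma chartDeriv_comp {f g : G → G} (hf : ContMDiffAt 𝓘(ℝ, E) 𝓘(ℝ, E) ∞ f 1)
    (hg : ContMDiffAt 𝓘(ℝ, E) 𝓘(ℝ, E) ∞ g 1) (hf1 : f 1 = 1) (hg1 : g 1 = 1) :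
    (chartDeriv (f ∘ g) : E →L[ℝ] E) = (chartDeriv f).comp (chartDeriv g) := by
  have h1 := (hasStrictFDerivAt_chartDeriv hg hg1).hasFDerivAt
  have h2 := (hasStrictFDerivAt_chartDeriv hf hf1).hasFDerivAt
  have h3 := HasFDerivAt.comp (x := origin E G) (f := fun x => (toChart (g (ofChart x : G)) : E))
    (g := fun x => (toChart (f (ofChart x : G)) : E)) (by simpa [hg1] using h2) h1
  refine (HasFDerivAt.congr_of_eventuallyEq h3 ?_).fderiv
  have : Tendsto (fun x : E => g (ofChart x : G)) (𝓝 (origin E G)) (𝓝 1) := by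
    have := hg.continuousAt.tendsto.comp (tendsto_ofChart (E := E))
    rwa [hg1] at this
  filter_upwards [this.eventually (eventually_ofChart_toChart (E := E) (G := G))] with x hx
  simp [hx]

/-- The adjoint action of `G` on its Lie algebra, in the chart at the identity. -/
def Ad (g : G) : E →L[ℝ] E := chartDeriv fun h : G => g * h * g⁻¹

lemma contMDiff_conj (g : G) : ContMDiff 𝓘(ℝ, E) 𝓘(ℝ, E) ∞ fun h : G => g * h * g⁻¹ :=
  (contMDiff_const.mul contMDiff_id).mul contMDiff_const

lemma hasStrictFDerivAt_conj (g : G) :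
    HasStrictFDerivAt (fun x => (toChart (g * (ofChart x : G) * g⁻¹) : E)) (Ad g) (origin E G) :=
  hasStrictFDerivAt_chartDeriv (contMDiff_conj g).contMDiffAt (by simp)

lemma Ad_one : (Ad (1 : G) : E →L[ℝ] E) = ContinuousLinearMap.id ℝ E := by
  rw [← chartDeriv_id (G := G)]
  simp [Ad, Function.id_def]

lemma Ad_mul (g h : G) : (Ad (g * h) : E →L[ℝ] E) = (Ad g).comp (Ad h) := by
  unfold Ad
  rw [← chartDeriv_comp (contMDiff_conj g).contMDiffAt (contMDiff_conj h).contMDiffAt (by simp)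
    (by simp)]
  congr 1
  funext x
  simp [mul_assoc]

lemma chartMul_origin_right : ∀ᶠ x in 𝓝 (origin E G), chartMul E G (x, origin E G) = x := by
  simpa [chartMul] using eventually_toChart_ofChart

lemma chartMul_origin_left : ∀ᶠ x in 𝓝 (origin E G), chartMul E G (origin E G, x) = x := by
  simpa [chartMul] using eventually_toChart_ofChart

lemma eventually_contDiffAt_chartMul :
    ∀ᶠ p in 𝓝 (origin E G, origin E G), ContDiffAt ℝ 2 (chartMul E G) p := by
  have h : ContDiffAt ℝ 2 (chartMul E G) (origin E G, origin E G) :=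
    contDiffAt_chartMul.of_le ENat.LEInfty.out
  exact h.eventually (by simp)

/-- Since `x * 1 = x` and `1 * x = x`, both partial derivatives at the identity are the identity
map. -/
lemma hasStrictFDerivAt_chartMul : HasStrictFDerivAt (chartMul E G)
    (ContinuousLinearMap.fst ℝ E E + ContinuousLinearMap.snd ℝ E E) (origin E G, origin E G) := by
  have h : HasStrictFDerivAt (chartMul E G) _ (origin E G, origin E G) :=
    contDiffAt_chartMul.hasStrictFDerivAt (by simp)
  suffices e : ContinuousLinearMap.fst ℝ E E + ContinuousLinearMap.snd ℝ E E =
      fderiv ℝ (chartMul E G) (origin E G, origin E G) by rwa [e]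
  have h1 : HasFDerivAt (fun x => chartMul E G (x, origin E G))
      ((fderiv ℝ (chartMul E G) (origin E G, origin E G)).comp
        ((ContinuousLinearMap.id ℝ E).prod 0)) (origin E G) :=
    HasFDerivAt.comp (origin E G) (f := fun x => (x, origin E G)) h.hasFDerivAt
      ((hasFDerivAt_id _).prodMk (hasFDerivAt_const _ _))
  have h2 : HasFDerivAt (fun x => chartMul E G (origin E G, x))
      ((fderiv ℝ (chartMul E G) (origin E G, origin E G)).comp
        ((0 : E →L[ℝ] E).prod (ContinuousLinearMap.id ℝ E))) (origin E G) :=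
    HasFDerivAt.comp (origin E G) (f := fun x => (origin E G, x)) h.hasFDerivAt
      ((hasFDerivAt_const _ _).prodMk (hasFDerivAt_id _))
  have h1' := h1.unique ((hasFDerivAt_id (𝕜 := ℝ) _).congr_of_eventuallyEq chartMul_origin_right)
  have h2' := h2.unique ((hasFDerivAt_id (𝕜 := ℝ) _).congr_of_eventuallyEq chartMul_origin_left)
  ext p
  · simpa using (congrArg (fun L => L p) h1').symm
  · simpa using (congrArg (fun L => L p) h2').symm

/-- `Φ : V → G` is continuous at `v` and its left logarithmic derivative at `v` is `D`. -/
def HasLeftDeriv (Φ : V → G) (D : V →L[ℝ] E) (v : V) : Prop :=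
  ContinuousAt Φ v ∧ HasStrictFDerivAt (fun w => (toChart ((Φ v)⁻¹ * Φ w) : E)) D v

lemma tendsto_inv_mul {Φ : V → G} [IsTopologicalGroup G] {v : V} (h : ContinuousAt Φ v) :
    Tendsto (fun w => (Φ v)⁻¹ * Φ w) (𝓝 v) (𝓝 1) := by
  have : ContinuousAt (fun w => (Φ v)⁻¹ * Φ w) v := continuousAt_const.mul h
  simpa [ContinuousAt] using this

namespace HasLeftDeriv

variable {Φ Ψ : V → G} {D D' : V →L[ℝ] E} {v : V}

lemma unique (h : HasLeftDeriv Φ D v) (h' : HasLeftDeriv Φ D' v) : D = D' :=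
  h.2.hasFDerivAt.unique h'.2.hasFDerivAt

variable [IsTopologicalGroup G]

lemma const (g : G) : HasLeftDeriv (fun _ : V => g) (0 : V →L[ℝ] E) v :=
  ⟨continuousAt_const, hasStrictFDerivAt_const _ _⟩

/-- Product rule: `(ΦΨ)(v)⁻¹ (ΦΨ)(w)` is the conjugate of `Φ(v)⁻¹ Φ(w)` by `Ψ(v)⁻¹`, times `Ψ(v)⁻¹
Ψ(w)`; near the identity the product is additive to first order. -/
lemma mul (h : HasLeftDeriv Φ D v) (h' : HasLeftDeriv Ψ D' v) :
    HasLeftDeriv (fun w => Φ w * Ψ w) ((Ad (Ψ v)⁻¹).comp D + D') v := by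
  refine ⟨h.1.mul h'.1, ?_⟩
  have h1 : HasStrictFDerivAt (fun w => (toChart ((Ψ v)⁻¹ * (ofChart
      (toChart ((Φ v)⁻¹ * Φ w) : E) : G) * (Ψ v)⁻¹⁻¹) : E)) ((Ad (Ψ v)⁻¹).comp D) v :=
    HasStrictFDerivAt.comp v (f := fun w => (toChart ((Φ v)⁻¹ * Φ w) : E))
      (g := fun x => (toChart ((Ψ v)⁻¹ * (ofChart x : G) * (Ψ v)⁻¹⁻¹) : E))
      (by simpa using (hasStrictFDerivAt_conj (E := E) (Ψ v)⁻¹)) h.2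
  have h2 := HasStrictFDerivAt.comp v (f := fun w => ((toChart ((Ψ v)⁻¹ * (ofChart
      (toChart ((Φ v)⁻¹ * Φ w) : E) : G) * (Ψ v)⁻¹⁻¹) : E), (toChart ((Ψ v)⁻¹ * Ψ w) : E)))
      (g := chartMul E G) (by simpa using hasStrictFDerivAt_chartMul) (h1.prodMk h'.2)
  have h3 : HasStrictFDerivAt (chartMul E G ∘ fun w => ((toChart ((Ψ v)⁻¹ * (ofChart
      (toChart ((Φ v)⁻¹ * Φ w) : E) : G) * (Ψ v)⁻¹⁻¹) : E), (toChart ((Ψ v)⁻¹ * Ψ w) : E)))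
      ((Ad (Ψ v)⁻¹).comp D + D') v := by
    refine h2.congr_fderiv ?_
    ext
    simp
  refine h3.congr_of_eventuallyEq ?_
  have t1 := tendsto_inv_mul h.1
  have t2 := tendsto_inv_mul h'.1
  have t3 : Tendsto (fun w => (Ψ v)⁻¹ * ((Φ v)⁻¹ * Φ w) * Ψ v) (𝓝 v) (𝓝 1) := by
    have := (t1.const_mul (Ψ v)⁻¹).mul_const (Ψ v)
    simpa using this
  filter_upwards [t1.eventually (eventually_ofChart_toChart (E := E)),
    t2.eventually (eventually_ofChart_toChart (E := E)),
    t3.eventually (eventually_ofChart_toChart (E := E))] with w e1 e2 e3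
  simp only [Function.comp, chartMul, e1, e2, inv_inv, e3]
  congr 1
  group

lemma comp {U : Type*} [NormedAddCommGroup U] [NormedSpace ℝ U] {f : U → V} {f' : U →L[ℝ] V}
    {u : U} (h : HasLeftDeriv Φ D (f u)) (hf : HasStrictFDerivAt f f' u) :
    HasLeftDeriv (fun x => Φ (f x)) (D.comp f') u :=
  ⟨ContinuousAt.comp (g := Φ) h.1 hf.continuousAt,
    HasStrictFDerivAt.comp u (g := fun w => (toChart ((Φ (f u))⁻¹ * Φ w) : E)) h.2 hf⟩

lemma map {A : G → G} (hA : ContMDiff 𝓘(ℝ, E) 𝓘(ℝ, E) ∞ A) (hmul : ∀ g h, A (g * h) = A g * A h)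
    (h : HasLeftDeriv Φ D v) : HasLeftDeriv (fun w => A (Φ w)) ((chartDeriv A).comp D) v := by
  have h1 : A 1 = 1 := by simpa using hmul 1 1
  have hinv : ∀ g, A g⁻¹ = (A g)⁻¹ := fun g => by
    rw [eq_inv_iff_mul_eq_one, ← hmul, inv_mul_cancel, h1]
  refine ⟨ContinuousAt.comp (g := A) hA.continuous.continuousAt h.1, ?_⟩
  have h2 := HasStrictFDerivAt.comp v (f := fun w => (toChart ((Φ v)⁻¹ * Φ w) : E))
    (g := fun x => (toChart (A (ofChart x : G)) : E))
    (by simpa using hasStrictFDerivAt_chartDeriv hA.contMDiffAt h1) h.2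
  refine h2.congr_of_eventuallyEq ?_
  filter_upwards [(tendsto_inv_mul h.1).eventually (eventually_ofChart_toChart (E := E))] with w e1
  simp only [e1, hmul, hinv]

lemma inv_apply_congr {g : G} (h : HasLeftDeriv Φ D v) : HasLeftDeriv (fun w => g * Φ w) D v := by
  refine ⟨continuousAt_const.mul h.1, ?_⟩
  have : (fun w => (toChart ((g * Φ v)⁻¹ * (g * Φ w)) : E)) =
      fun w => toChart ((Φ v)⁻¹ * Φ w) := by
    funext w; congr 1; group
  rw [this]; exact h.2

end HasLeftDeriv

variable (E G) in
/-- In the chart, the left-invariant frame: the derivative of `y ↦ x * y` at the identity. -/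
def chartFrame (x : E) : E →L[ℝ] E :=
  (fderiv ℝ (chartMul E G) (x, origin E G)).comp ((0 : E →L[ℝ] E).prod (ContinuousLinearMap.id ℝ E))

lemma eventually_hasStrictFDerivAt_chartMul_right : ∀ᶠ x in 𝓝 (origin E G),
    HasStrictFDerivAt (fun y => chartMul E G (x, y)) (chartFrame E G x) (origin E G) := by
  have : Tendsto (fun x : E => (x, origin E G)) (𝓝 (origin E G))
      (𝓝 (origin E G, origin E G)) := by
    exact (Continuous.prodMk_left (origin E G)).tendsto (origin E G)
  filter_upwards [this.eventually eventually_contDiffAt_chartMul] with x hx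
  exact HasStrictFDerivAt.comp (origin E G) (f := fun y => (x, y))
    (hx.hasStrictFDerivAt (by simp))
    ((hasStrictFDerivAt_const _ _).prodMk (hasStrictFDerivAt_id _))

lemma chartFrame_origin : chartFrame E G (origin E G) = ContinuousLinearMap.id ℝ E := by
  ext x
  simp [chartFrame, hasStrictFDerivAt_chartMul.hasFDerivAt.fderiv]

lemma continuousAt_chartFrame : ContinuousAt (chartFrame E G) (origin E G) := by
  have h : ContDiffAt ℝ 1 (fderiv ℝ (chartMul E G)) (origin E G, origin E G) :=
    contDiffAt_chartMul.fderiv_right (by rw [one_add_one_eq_two]; exact ENat.LEInfty.out)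
  have h2 : ContinuousAt (fun x : E => fderiv ℝ (chartMul E G) (x, origin E G)) (origin E G) :=
    ContinuousAt.comp (f := fun x : E => (x, origin E G)) h.continuousAt
      (Continuous.prodMk_left (origin E G)).continuousAt
  exact h2.clm_comp continuousAt_const

variable [IsTopologicalGroup G]

/-- The derivative of a map in the chart, from its left logarithmic derivative. -/
lemma eventually_hasStrictFDerivAt_toChart : ∀ᶠ g in 𝓝 (1 : G), ∀ (Φ : V → G) (D : V →L[ℝ] E) (v : V),
    Φ v = g → HasLeftDeriv Φ D v →
    HasStrictFDerivAt (fun w => (toChart (Φ w) : E)) ((chartFrame E G (toChart (Φ v))).comp D) v := by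
  filter_upwards [(eventually_ofChart_toChart (E := E)), tendsto_toChart.eventually
    (eventually_hasStrictFDerivAt_chartMul_right (E := E) (G := G))] with g h1 h2
  rintro Φ D v rfl h
  have h3 := HasStrictFDerivAt.comp v (f := fun w => (toChart ((Φ v)⁻¹ * Φ w) : E))
    (g := fun y => chartMul E G (toChart (Φ v), y)) (by simpa using h2) h.2
  refine h3.congr_of_eventuallyEq ?_
  filter_upwards [(tendsto_inv_mul h.1).eventually (eventually_ofChart_toChart (E := E))] with w e1
  simp [chartMul, e1, h1]

/-- A map whose left logarithmic derivative vanishes is constant. -/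
lemma eq_of_hasLeftDeriv_zero [T2Space G] {c : V → G}
    (h : ∀ v, HasLeftDeriv c (0 : V →L[ℝ] E) v) (v w : V) : c v = c w := by
  have hc : Continuous c := continuous_iff_continuousAt.2 fun v => (h v).1
  refine IsLocallyConstant.apply_eq_of_isPreconnected (s := univ) ?_ isPreconnected_univ
    (mem_univ _) (mem_univ _)
  rw [IsLocallyConstant.iff_eventually_eq]
  intro v
  have e1 := (tendsto_inv_mul (hc.continuousAt (x := v))).eventually
    ((eventually_hasStrictFDerivAt_toChart (E := E) (V := V)).and
      (eventually_ofChart_toChart (E := E)))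
  obtain ⟨r, hr, hball⟩ := Metric.eventually_nhds_iff_ball.1 e1
  have hd : ∀ w ∈ Metric.ball v r,
      HasFDerivWithinAt (fun w => (toChart ((c v)⁻¹ * c w) : E)) (0 : V →L[ℝ] E)
        (Metric.ball v r) w := by
    intro w hw
    have := (hball w hw).1 (fun w => (c v)⁻¹ * c w) 0 w rfl (h w).inv_apply_congr
    simpa using this.hasFDerivAt.hasFDerivWithinAt
  filter_upwards [Metric.ball_mem_nhds v hr] with w hw
  have hconst := (convex_ball v r).is_const_of_fderivWithin_eq_zero (𝕜 := ℝ)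
    (f := fun w => (toChart ((c v)⁻¹ * c w) : E))
    (fun w hw => (hd w hw).differentiableWithinAt)
    (fun w hw => (hd w hw).fderivWithin (Metric.isOpen_ball.uniqueDiffWithinAt hw)) hw
    (Metric.mem_ball_self hr)
  have e2 := congrArg (ofChart : E → G) hconst
  simp only [(hball w hw).2, (hball v (Metric.mem_ball_self hr)).2] at e2
  exact (mul_left_cancel e2)

end LocalGroup

end NilAnosov

namespace NilAnosov

open Filter Topology Set

/-! ### Integral curves of left-invariant fields, translated into chart calculus. -/

section Exponential

variable {E : Type*} [NormedAddCommGroup E] [NormedSpace ℝ E]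
  {G : Type*} [TopologicalSpace G] [ChartedSpace E G] [Group G]
  {V : Type*} [NormedAddCommGroup V] [NormedSpace ℝ V]

lemma HasMFDerivAt.hasFDerivAt_toChart {f : V → G} {v : V} {L : V →L[ℝ] E}
    (h : HasMFDerivAt 𝓘(ℝ, V) 𝓘(ℝ, E) f v L) (h1 : f v = 1) :
    HasFDerivAt (fun w => (toChart (f w) : E)) L v := by
  -- The manifold derivative uses the chart centred at `f v`. A free base point `g` lets `f v = 1`
  -- be substituted although the types depend on it.
  have h2 : ∀ g, f v = g → HasFDerivAt (fun w => extChartAt 𝓘(ℝ, E) g (f w)) L v := by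
    rintro g rfl
    have h3 : HasFDerivWithinAt (fun w => extChartAt 𝓘(ℝ, E) (f v) (f w)) L (range 𝓘(ℝ, V)) v :=
      h.2
    rwa [ModelWithCorners.range_eq_univ, hasFDerivWithinAt_univ] at h3
  simpa [toChart] using h2 1 h1

lemma hasMFDerivAt_of_hasFDerivAt_toChart {f : V → G} {v : V} {L : V →L[ℝ] E}
    (hc : ContinuousAt f v) (h1 : f v = 1) (h : HasFDerivAt (fun w => (toChart (f w) : E)) L v) :
    HasMFDerivAt 𝓘(ℝ, V) 𝓘(ℝ, E) f v L := by
  refine ⟨hc, ?_⟩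
  have h2 : ∀ g, f v = g → HasFDerivAt (fun w => extChartAt 𝓘(ℝ, E) g (f w)) L v →
      HasFDerivWithinAt (writtenInExtChartAt 𝓘(ℝ, V) 𝓘(ℝ, E) v f) L (range 𝓘(ℝ, V))
        (extChartAt 𝓘(ℝ, V) v v) := by
    rintro g rfl h
    exact HasFDerivAt.hasFDerivWithinAt (x := v) h
  exact h2 1 h1 (by simpa [toChart] using h)

variable [LieGroup 𝓘(ℝ, E) ∞ G]

lemma mfderiv_one_eq_chartDeriv {f : G → G} (hf : ContMDiffAt 𝓘(ℝ, E) 𝓘(ℝ, E) ∞ f 1)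
    (h1 : f 1 = 1) (v : E) :
    (mfderiv 𝓘(ℝ, E) 𝓘(ℝ, E) f 1 : E →L[ℝ] E) v = chartDeriv f v := by
  have hd : MDifferentiableAt 𝓘(ℝ, E) 𝓘(ℝ, E) f 1 := hf.mdifferentiableAt (by simp)
  have h2 : ∀ g, f 1 = g → (mfderiv 𝓘(ℝ, E) 𝓘(ℝ, E) f 1 : E →L[ℝ] E) =
      fderiv ℝ (fun x => extChartAt 𝓘(ℝ, E) g (f ((extChartAt 𝓘(ℝ, E) (1 : G)).symm x)))
        (extChartAt 𝓘(ℝ, E) (1 : G) 1) := by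
    rintro g rfl
    have key : ∀ L : E →L[ℝ] E, HasMFDerivAt 𝓘(ℝ, E) 𝓘(ℝ, E) f 1 L →
        L = fderiv ℝ (fun x => extChartAt 𝓘(ℝ, E) (f 1)
          (f ((extChartAt 𝓘(ℝ, E) (1 : G)).symm x))) (extChartAt 𝓘(ℝ, E) (1 : G) 1) := by
      intro L hL
      have h3 : HasFDerivWithinAt (fun x => extChartAt 𝓘(ℝ, E) (f 1)
        (f ((extChartAt 𝓘(ℝ, E) (1 : G)).symm x))) L
        (range 𝓘(ℝ, E)) (extChartAt 𝓘(ℝ, E) (1 : G) 1) := hL.2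
      rw [ModelWithCorners.range_eq_univ, hasFDerivWithinAt_univ] at h3
      exact h3.fderiv.symm
    exact key _ hd.hasMFDerivAt
  rw [h2 1 h1]
  rfl

/-- Left translation, as a linear map on tangent spaces identified with `E`. -/
lemma mfderiv_mul_left_cancel (g k : G) (hk : g * 1 = k) (v : E) :
    (mfderiv 𝓘(ℝ, E) 𝓘(ℝ, E) (fun h => g⁻¹ * h) k : E →L[ℝ] E)
      ((mfderiv 𝓘(ℝ, E) 𝓘(ℝ, E) (fun h => g * h) 1 : E →L[ℝ] E) v) = v := by
  subst hk
  have h1 : MDifferentiableAt 𝓘(ℝ, E) 𝓘(ℝ, E) (fun h : G => g⁻¹ * h) (g * 1) :=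
    (contMDiff_mul_left (n := ∞)).mdifferentiableAt (by simp)
  have h2 : MDifferentiableAt 𝓘(ℝ, E) 𝓘(ℝ, E) (fun h : G => g * h) 1 :=
    (contMDiff_mul_left (n := ∞)).mdifferentiableAt (by simp)
  have h3 := mfderiv_comp (x := (1 : G)) h1 h2
  have h4 : (fun h : G => g⁻¹ * h) ∘ (fun h : G => g * h) = id := by ext x; simp
  rw [h4, mfderiv_id] at h3
  exact (DFunLike.congr_fun h3 v).symm

/-- Bridge between the two languages: solving the ODE of the left-invariant field means having
constant left logarithmic derivative `v`, a condition visibly stable under left translation. -/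
lemma hasMFDerivAt_curve_iff {γ : ℝ → G} {v : E} {t : ℝ} :
    HasMFDerivAt 𝓘(ℝ, ℝ) 𝓘(ℝ, E) γ t ((1 : ℝ →L[ℝ] ℝ).smulRight
      (mulInvariantVectorField (I := 𝓘(ℝ, E)) (v : GroupLieAlgebra 𝓘(ℝ, E) G) (γ t))) ↔
    ContinuousAt γ t ∧ HasDerivAt (fun s => (toChart ((γ t)⁻¹ * γ s) : E)) v t := by
  have := topologicalGroup_of_lieGroup 𝓘(ℝ, E) ∞ (G := G)
  constructor
  · intro h
    refine ⟨h.1, ?_⟩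
    have h1 : MDifferentiableAt 𝓘(ℝ, E) 𝓘(ℝ, E) (fun h : G => (γ t)⁻¹ * h) (γ t) :=
      (contMDiff_mul_left (n := ∞)).mdifferentiableAt (by simp)
    have h2 := h1.hasMFDerivAt.comp t h
    have h3 := HasMFDerivAt.hasFDerivAt_toChart h2 (by simp)
    refine (hasFDerivAt_iff_hasDerivAt.1 h3).congr_deriv ?_
    refine Eq.trans ?_ (mfderiv_mul_left_cancel (γ t) (γ t) (mul_one _) v)
    refine congrArg (mfderiv 𝓘(ℝ, E) 𝓘(ℝ, E) (fun h => (γ t)⁻¹ * h) (γ t) : E →L[ℝ] E) ?_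
    exact one_smul ℝ _
  · rintro ⟨hc, h⟩
    have hc' := tendsto_inv_mul hc
    have h1 := hasMFDerivAt_of_hasFDerivAt_toChart (f := fun s => (γ t)⁻¹ * γ s)
      (continuousAt_const.mul hc) (by simp) h.hasFDerivAt
    have h2 : ∀ g, g = (γ t)⁻¹ * γ t → HasMFDerivAt 𝓘(ℝ, E) 𝓘(ℝ, E) (fun h : G => γ t * h) g
       (mfderiv 𝓘(ℝ, E) 𝓘(ℝ, E) (fun h : G => γ t * h) g) := fun g _ =>
      MDifferentiableAt.hasMFDerivAt ((contMDiff_mul_left (n := ∞)).mdifferentiableAt (by simp))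
    have h3 := (h2 _ rfl).comp t h1
    have h4 : (fun h : G => γ t * h) ∘ (fun s => (γ t)⁻¹ * γ s) = γ := by ext; simp
    rw [h4] at h3
    refine h3.congr_mfderiv ?_
    have h5 : ∀ g : G, g = 1 → (mfderiv 𝓘(ℝ, E) 𝓘(ℝ, E) (fun h : G => γ t * h) g : E →L[ℝ] E) v =
      (mfderiv 𝓘(ℝ, E) 𝓘(ℝ, E) (fun h : G => γ t * h) 1 : E →L[ℝ] E) v := by rintro g rfl; rfl
    refine ContinuousLinearMap.ext_ring ?_
    refine Eq.trans ?_ ((h5 ((γ t)⁻¹ * γ t) (by simp)).trans ?_)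
    · refine congrArg (mfderiv 𝓘(ℝ, E) 𝓘(ℝ, E) (fun h : G => γ t * h) ((γ t)⁻¹ * γ t) : E →L[ℝ] E) ?_
      exact one_smul ℝ v
    · exact (one_smul ℝ ((mfderiv 𝓘(ℝ, E) 𝓘(ℝ, E) (fun h : G => γ t * h) 1 : E →L[ℝ] E) v)).symm

/-- Left translates of one local solution through the identity solve the equation from every point
for the same time `ε`, so solutions extend to all of `ℝ`. -/
lemma exists_isMIntegralCurve_mulInvariantVectorField [FiniteDimensional ℝ E] [T2Space G]
    (v : GroupLieAlgebra 𝓘(ℝ, E) G) :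
    ∃ γ : ℝ → G, γ 0 = 1 ∧ IsMIntegralCurve (I := 𝓘(ℝ, E)) γ (mulInvariantVectorField v) := by
  have := topologicalGroup_of_lieGroup 𝓘(ℝ, E) ∞ (G := G)
  have : CompleteSpace E := FiniteDimensional.complete ℝ E
  have : LieGroup 𝓘(ℝ, E) (minSmoothness ℝ 3) G :=
    LieGroup.of_le (n := ∞) (by rw [minSmoothness_of_isRCLikeNormedField]; exact ENat.LEInfty.out)
  have hv := (contMDiff_mulInvariantVectorField (I := 𝓘(ℝ, E)) (G := G) v).of_le (m := 1)
    (by rw [minSmoothness_of_isRCLikeNormedField]; exact one_le_two)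
  obtain ⟨γ, h0, hγ⟩ := exists_isMIntegralCurveAt_of_contMDiffAt_boundaryless (x₀ := (1 : G)) 0
    hv.contMDiffAt
  obtain ⟨ε, hε, hγ⟩ := isMIntegralCurveAt_iff'.1 hγ
  refine exists_isMIntegralCurve_of_isMIntegralCurveOn hv hε (fun x => ⟨fun t => x * γ t, ?_, ?_⟩) 1
  · simp [h0]
  · intro t ht
    have h1 := (hγ t (by simpa [Real.ball_eq_Ioo] using ht)).hasMFDerivAt
      (Metric.isOpen_ball.mem_nhds (by simpa [Real.ball_eq_Ioo] using ht))
    have h2 := hasMFDerivAt_curve_iff.1 h1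
    refine HasMFDerivAt.hasMFDerivWithinAt (hasMFDerivAt_curve_iff.2 ⟨continuousAt_const.mul h2.1, ?_⟩)
    refine h2.2.congr_of_eventuallyEq (Eventually.of_forall fun s => ?_)
    simp only
    congr 1
    group

end Exponential

end NilAnosov

namespace NilAnosov

open Filter Topology Set

/-! ### The Lie bracket as a second-order term, and as the derivative of `Ad`. -/

section Bracket

variable {E : Type*} [NormedAddCommGroup E] [NormedSpace ℝ E]
  {G : Type*} [TopologicalSpace G] [ChartedSpace E G] [Group G]
  {V : Type*} [NormedAddCommGroup V] [NormedSpace ℝ V]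
  [LieGroup 𝓘(ℝ, E) ∞ G]

variable (E G) in
/-- The Lie bracket in the chart at the identity: the antisymmetrized second-order term of the
multiplication. -/
def chartBracket : E →L[ℝ] E →L[ℝ] E :=
  fderiv ℝ (chartFrame E G) (origin E G) - (fderiv ℝ (chartFrame E G) (origin E G)).flip

/-- In the chart a left-invariant field is a constant combination of `chartFrame`, so the bracket of
the Lie algebra becomes a flat bracket of vector fields on `E`. -/
lemma mpullbackWithin_mulInvariantVectorField (v : E) : ∀ᶠ x in 𝓝 (origin E G),
    VectorField.mpullbackWithin 𝓘(ℝ, E) 𝓘(ℝ, E) (extChartAt 𝓘(ℝ, E) (1 : G)).symm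
      (mulInvariantVectorField (v : GroupLieAlgebra 𝓘(ℝ, E) G)) (range 𝓘(ℝ, E)) x =
    chartFrame E G x v := by
  filter_upwards [(eventually_hasStrictFDerivAt_chartMul_right (E := E) (G := G)),
    extChartAt_target_mem_nhds (I := 𝓘(ℝ, E)) (1 : G)] with x hx hx'
  have h1 := mfderiv_extChartAt_comp_mfderivWithin_extChartAt_symm (I := 𝓘(ℝ, E)) hx'
  have h2 := mfderivWithin_extChartAt_symm_comp_mfderiv_extChartAt (I := 𝓘(ℝ, E)) hx'
  have h3 := ContinuousLinearMap.inverse_eq h2 h1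
  rw [VectorField.mpullbackWithin, h3]
  set g : G := (extChartAt 𝓘(ℝ, E) (1 : G)).symm x with hg
  have hgs : g ∈ (chartAt E (1 : G)).source := by
    rw [← extChartAt_source 𝓘(ℝ, E)]; exact (extChartAt 𝓘(ℝ, E) (1 : G)).map_target hx'
  have key : ∀ k : G, k = g → ∀ h : G → G, h = (fun a => g * a) → h 1 = k →
      ∀ L : E →L[ℝ] E, HasMFDerivAt 𝓘(ℝ, E) 𝓘(ℝ, E) h 1 L →
      (mfderiv 𝓘(ℝ, E) 𝓘(ℝ, E) (extChartAt 𝓘(ℝ, E) (1 : G)) k : E →L[ℝ] E) (L v) =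
        chartFrame E G x v := by
    rintro k hk h hh rfl L hL
    have hd : MDifferentiableAt 𝓘(ℝ, E) 𝓘(ℝ, E) (extChartAt 𝓘(ℝ, E) (1 : G)) (h 1) :=
      mdifferentiableAt_extChartAt (by rw [hk]; exact hgs)
    have h4 := (hd.hasMFDerivAt.comp (1 : G) hL).2
    have key2 : ∀ M : E →L[ℝ] E, HasFDerivWithinAt (writtenInExtChartAt 𝓘(ℝ, E) 𝓘(ℝ, E) (1 : G)
        (extChartAt 𝓘(ℝ, E) (1 : G) ∘ h)) M (range 𝓘(ℝ, E)) (extChartAt 𝓘(ℝ, E) (1 : G) 1) →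
        M = chartFrame E G x := by
      intro M hM
      rw [ModelWithCorners.range_eq_univ, hasFDerivWithinAt_univ] at hM
      subst hh
      exact HasFDerivAt.unique hM hx.hasFDerivAt
    exact DFunLike.congr_fun (key2 _ h4) v
  exact key g rfl _ rfl (mul_one g) _ (MDifferentiableAt.hasMFDerivAt
    ((contMDiff_mul_left (n := ∞)).mdifferentiableAt (by simp)))

lemma differentiableAt_chartFrame : DifferentiableAt ℝ (chartFrame E G) (origin E G) := by
  have h : ContDiffAt ℝ 1 (fderiv ℝ (chartMul E G)) (origin E G, origin E G) :=
    contDiffAt_chartMul.fderiv_right (by rw [one_add_one_eq_two]; exact ENat.LEInfty.out)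
  have h2 : DifferentiableAt ℝ (fun x : E => fderiv ℝ (chartMul E G) (x, origin E G))
      (origin E G) :=
    DifferentiableAt.comp (origin E G) (f := fun x : E => (x, origin E G))
      (h.differentiableAt (by simp)) (differentiableAt_id.prodMk (differentiableAt_const _))
  exact h2.clm_comp (differentiableAt_const _)

lemma lieBracketWithin_eq_chartBracket {v w : E} {X Y : E → E}
    (hX : ∀ᶠ x in 𝓝 (origin E G), X x = chartFrame E G x v)
    (hY : ∀ᶠ x in 𝓝 (origin E G), Y x = chartFrame E G x w) {s : Set E} (hs : s = univ) :
    VectorField.lieBracketWithin ℝ X Y s (origin E G) = chartBracket E G v w := by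
  rw [hs, VectorField.lieBracketWithin_univ, EventuallyEq.lieBracket_vectorField_eq (𝕜 := ℝ) hX hY,
    VectorField.lieBracket_eq]
  have h3 := (differentiableAt_chartFrame (E := E) (G := G)).hasFDerivAt
  have h4 : ∀ u : E, fderiv ℝ (fun x => chartFrame E G x u) (origin E G) =
      (fderiv ℝ (chartFrame E G) (origin E G)).flip u := fun u => by
    have := (h3.clm_apply (hasFDerivAt_const u _)).fderiv
    rw [this]; ext; simp
  simp [h4, chartFrame_origin, chartBracket]

lemma bracket_eq_chartBracket (v w : GroupLieAlgebra 𝓘(ℝ, E) G) :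
    ⁅v, w⁆ = (chartBracket E G v w : E) := by
  have h := lieBracketWithin_eq_chartBracket (E := E) (v := v) (w := w) (mpullbackWithin_mulInvariantVectorField (E := E) (G := G) v)
    (mpullbackWithin_mulInvariantVectorField (E := E) (G := G) w)
    (by rw [preimage_univ, univ_inter, ModelWithCorners.range_eq_univ] :
      (extChartAt 𝓘(ℝ, E) (1 : G)).symm ⁻¹' univ ∩ range 𝓘(ℝ, E) = univ)
  have key : ∀ (L : E →L[ℝ] E) (u : E), L = ContinuousLinearMap.id ℝ E →
      u = chartBracket E G v w → L.inverse u = chartBracket E G v w := by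
    rintro _ _ rfl rfl
    rw [ContinuousLinearMap.inverse_id]; rfl
  exact key (mfderiv 𝓘(ℝ, E) 𝓘(ℝ, E) (extChartAt 𝓘(ℝ, E) (1 : G)) 1) _ mfderiv_extChartAt_self h

variable [IsTopologicalGroup G]

lemma eventually_chartMul_chartConj : ∀ᶠ p in 𝓝 (origin E G, origin E G),
    chartMul E G (chartConj E G p, p.1) = chartMul E G p := by
  have t1 : Tendsto (fun p : E × E => (ofChart p.1 : G)) (𝓝 (origin E G, origin E G)) (𝓝 1) :=
    tendsto_ofChart.comp continuous_fst.continuousAt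
  have t2 : Tendsto (fun p : E × E => (ofChart p.2 : G)) (𝓝 (origin E G, origin E G)) (𝓝 1) :=
    tendsto_ofChart.comp continuous_snd.continuousAt
  have t3 : Tendsto (fun p : E × E => (ofChart p.1 * ofChart p.2 * (ofChart p.1)⁻¹ : G))
      (𝓝 (origin E G, origin E G)) (𝓝 1) := by
    simpa using (t1.mul t2).mul t1.inv
  filter_upwards [t3.eventually (eventually_ofChart_toChart (E := E))] with p hp
  simp [chartMul, chartConj, hp]

lemma eventually_Ad_ofChart : ∀ᶠ x in 𝓝 (origin E G), Ad (ofChart x : G) =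
    (fderiv ℝ (chartConj E G) (x, origin E G)).comp
      ((0 : E →L[ℝ] E).prod (ContinuousLinearMap.id ℝ E)) := by
  have h : ContDiffAt ℝ 2 (chartConj E G) (origin E G, origin E G) :=
    contDiffAt_chartConj.of_le ENat.LEInfty.out
  have : Tendsto (fun x : E => (x, origin E G)) (𝓝 (origin E G))
      (𝓝 (origin E G, origin E G)) :=
    (Continuous.prodMk_left (origin E G)).tendsto (origin E G)
  filter_upwards [this.eventually (h.eventually (by simp))] with x hx
  exact (HasFDerivAt.comp (origin E G) (f := fun y => (x, y))
    (hx.differentiableAt (by simp)).hasFDerivAt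
    ((hasFDerivAt_const _ _).prodMk (hasFDerivAt_id _))).fderiv

/-- Derivative in `y` at the identity of `(x y x⁻¹) x = x y`: right translation of `Ad x w` equals
left translation of `w`. -/
lemma eventually_frame_Ad (w : E) : ∀ᶠ x in 𝓝 (origin E G),
    fderiv ℝ (chartMul E G) (origin E G, x) (Ad (ofChart x : G) w, 0) = chartFrame E G x w := by
  have h := eventually_chartMul_chartConj (E := E) (G := G)
  rw [nhds_prod_eq] at h
  have t1 : Tendsto (fun x : E => (origin E G, x)) (𝓝 (origin E G))
      (𝓝 (origin E G, origin E G)) :=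
    (Continuous.prodMk_right (origin E G)).tendsto (origin E G)
  filter_upwards [h.curry, eventually_hasStrictFDerivAt_chartMul_right (E := E) (G := G),
    t1.eventually (eventually_contDiffAt_chartMul (E := E) (G := G))] with x hx h1 h2
  have hc : chartConj E G (x, origin E G) = origin E G := by simp [chartConj]
  have h3 : HasFDerivAt (fun y => (chartConj E G (x, y), x))
      ((Ad (ofChart x : G)).prod (0 : E →L[ℝ] E)) (origin E G) :=
    (hasStrictFDerivAt_conj (ofChart x : G)).hasFDerivAt.prodMk (hasFDerivAt_const _ _)
  have h4 : HasFDerivAt (fun y => chartMul E G (chartConj E G (x, y), x)) _ (origin E G) :=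
    HasFDerivAt.comp (origin E G) (g := chartMul E G)
      (by rw [hc]; exact (h2.differentiableAt (by simp)).hasFDerivAt) h3
  have h5 := h4.unique (h1.hasFDerivAt.congr_of_eventuallyEq hx)
  simpa using DFunLike.congr_fun h5 w

/-- The derivative of the adjoint action at the identity is the bracket. -/
lemma hasFDerivAt_Ad (w : E) : HasFDerivAt (fun x => Ad (ofChart x : G) w)
    ((chartBracket E G).flip w) (origin E G) := by
  set e := origin E G with he
  have hc : ContDiffAt ℝ 1 (fderiv ℝ (chartConj E G)) (e, e) :=
    contDiffAt_chartConj.fderiv_right (by rw [one_add_one_eq_two]; exact ENat.LEInfty.out)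
  have hm : ContDiffAt ℝ 1 (fderiv ℝ (chartMul E G)) (e, e) :=
    contDiffAt_chartMul.fderiv_right (by rw [one_add_one_eq_two]; exact ENat.LEInfty.out)
  have hm2 : ContDiffAt ℝ 2 (chartMul E G) (e, e) :=
    contDiffAt_chartMul.of_le ENat.LEInfty.out
  have hsymm : IsSymmSndFDerivAt ℝ (chartMul E G) (e, e) := hm2.isSymmSndFDerivAt (by simp)
  have hA : DifferentiableAt ℝ (fun x => Ad (ofChart x : G) w) e := by
    have h2 : DifferentiableAt ℝ (fun x : E => fderiv ℝ (chartConj E G) (x, e)) e :=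
      DifferentiableAt.comp e (f := fun x : E => (x, e))
        (hc.differentiableAt (by simp)) (differentiableAt_id.prodMk (differentiableAt_const _))
    have h3 := (h2.clm_comp (differentiableAt_const
      ((0 : E →L[ℝ] E).prod (ContinuousLinearMap.id ℝ E)))).clm_apply (differentiableAt_const w)
    refine h3.congr_of_eventuallyEq ?_
    filter_upwards [eventually_Ad_ofChart (E := E) (G := G)] with x hx
    rw [hx]
  obtain ⟨a', ha'⟩ := hA
  have hM := (hm.differentiableAt (by simp)).hasFDerivAt
  have hM1 : HasFDerivAt (fun x => fderiv ℝ (chartMul E G) (e, x))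
      ((fderiv ℝ (fderiv ℝ (chartMul E G)) (e, e)).comp
        ((0 : E →L[ℝ] E).prod (ContinuousLinearMap.id ℝ E))) e :=
    HasFDerivAt.comp e (f := fun x => (e, x)) hM
      ((hasFDerivAt_const _ _).prodMk (hasFDerivAt_id _))
  have hM2 : HasFDerivAt (fun x => fderiv ℝ (chartMul E G) (x, e))
      ((fderiv ℝ (fderiv ℝ (chartMul E G)) (e, e)).comp
        ((ContinuousLinearMap.id ℝ E).prod (0 : E →L[ℝ] E))) e :=
    HasFDerivAt.comp e (f := fun x => (x, e)) hM
      ((hasFDerivAt_id _).prodMk (hasFDerivAt_const _ _))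
  have hF : ∀ v u, fderiv ℝ (chartFrame E G) e v u =
      fderiv ℝ (fderiv ℝ (chartMul E G)) (e, e) (v, 0) (0, u) := by
    intro v u
    have h3 : HasFDerivAt (fun x => chartFrame E G x u) _ e := 
      (hM2.clm_comp (hasFDerivAt_const ((0 : E →L[ℝ] E).prod (ContinuousLinearMap.id ℝ E)) e)
        ).clm_apply (hasFDerivAt_const u e)
    have h4 := (differentiableAt_chartFrame (E := E) (G := G)).hasFDerivAt.clm_apply
      (hasFDerivAt_const u e)
    simpa using DFunLike.congr_fun (h4.unique h3) v
  have hL := hM1.clm_apply (ha'.prodMk (hasFDerivAt_const (0 : E) e))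
  have hR : HasFDerivAt (fun x => chartFrame E G x w) _ e :=
    (differentiableAt_chartFrame (E := E) (G := G)).hasFDerivAt.clm_apply (hasFDerivAt_const w e)
  -- Differentiating the identity of `eventually_frame_Ad` in `x` gives `D²m((0,v),(w,0)) + a' v =
  -- D²m((v,0),(0,w))`, where `m` is `chartMul`. Symmetry of `D²m` then turns `a' v` into the
  -- antisymmetrized second-order term.
  have hLR := hL.unique (hR.congr_of_eventuallyEq (eventually_frame_Ad w))
  have hfin : a' = (chartBracket E G).flip w := by
    ext v
    have h5 := DFunLike.congr_fun hLR v
    have h6 := hsymm (0, v) (w, 0)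
    have h7 := (hasStrictFDerivAt_chartMul (E := E) (G := G)).hasFDerivAt.fderiv
    have h8 := hF w v
    have h9 : Ad (ofChart e : G) w = w := by rw [he, ofChart_origin, Ad_one]; rfl
    rw [← he] at h7
    simp only [add_apply, ContinuousLinearMap.comp_apply,
      ContinuousLinearMap.flip_apply, ContinuousLinearMap.prod_apply, h7, h9,
      zero_apply, ContinuousLinearMap.id_apply, h6, ← h8,
      ContinuousLinearMap.coe_fst', ContinuousLinearMap.coe_snd', add_zero, map_zero, zero_add] at h5
    simp only [chartBracket, ContinuousLinearMap.flip_apply, sub_apply]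
    exact eq_sub_of_add_eq h5
  rwa [← hfin]

end Bracket

end NilAnosov

namespace NilAnosov

open Filter Topology Set

/-! ### One-parameter subgroups, `Ad` along them, and nilpotency of the Lie algebra. -/

section ExpCurve

variable {E : Type*} [NormedAddCommGroup E] [NormedSpace ℝ E] [FiniteDimensional ℝ E]
  {G : Type*} [TopologicalSpace G] [T2Space G] [ChartedSpace E G] [Group G]
  [LieGroup 𝓘(ℝ, E) ∞ G]

/-- The one-parameter subgroup of `G` with initial velocity `X`. -/
def expCurve (X : E) : ℝ → G :=
  Classical.choose (exists_isMIntegralCurve_mulInvariantVectorField (G := G)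
    (X : GroupLieAlgebra 𝓘(ℝ, E) G))

@[simp] lemma expCurve_zero (X : E) : (expCurve X 0 : G) = 1 :=
  (Classical.choose_spec (exists_isMIntegralCurve_mulInvariantVectorField (G := G)
    (X : GroupLieAlgebra 𝓘(ℝ, E) G))).1

lemma isMIntegralCurve_expCurve (X : E) : IsMIntegralCurve (I := 𝓘(ℝ, E)) (expCurve X : ℝ → G)
    (mulInvariantVectorField (X : GroupLieAlgebra 𝓘(ℝ, E) G)) :=
  (Classical.choose_spec (exists_isMIntegralCurve_mulInvariantVectorField (G := G)
    (X : GroupLieAlgebra 𝓘(ℝ, E) G))).2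

lemma isMIntegralCurve_eq_of_apply_zero_eq (X : E) {γ γ' : ℝ → G}
    (h : IsMIntegralCurve (I := 𝓘(ℝ, E)) γ
      (mulInvariantVectorField (X : GroupLieAlgebra 𝓘(ℝ, E) G)))
    (h' : IsMIntegralCurve (I := 𝓘(ℝ, E)) γ'
      (mulInvariantVectorField (X : GroupLieAlgebra 𝓘(ℝ, E) G))) (h0 : γ 0 = γ' 0) : γ = γ' := by
  have : CompleteSpace E := FiniteDimensional.complete ℝ E
  have : LieGroup 𝓘(ℝ, E) (minSmoothness ℝ 3) G :=
    LieGroup.of_le (n := ∞) (by rw [minSmoothness_of_isRCLikeNormedField]; exact ENat.LEInfty.out)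
  have hv := (contMDiff_mulInvariantVectorField (I := 𝓘(ℝ, E)) (G := G) X).of_le (m := 1)
    (by rw [minSmoothness_of_isRCLikeNormedField]; exact one_le_two)
  exact isMIntegralCurve_Ioo_eq_of_contMDiff_boundaryless (t₀ := 0) hv h h' h0

lemma isMIntegralCurve_of_hasLeftDeriv {X : E} {γ : ℝ → G}
    (h : ∀ t, HasLeftDeriv γ (ContinuousLinearMap.toSpanSingleton ℝ X) t) :
    IsMIntegralCurve (I := 𝓘(ℝ, E)) γ
      (mulInvariantVectorField (X : GroupLieAlgebra 𝓘(ℝ, E) G)) := fun t =>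
  hasMFDerivAt_curve_iff.2 ⟨(h t).1, (h t).2.hasFDerivAt⟩

lemma isExp_expCurve (X : E) (t : ℝ) :
    IsExp (E := E) (t • X : E) (expCurve X t : G) := by
  refine ⟨expCurve X ∘ (· * t), ?_, by simp, by simp⟩
  have e := mulInvariantVectorField_smul (I := 𝓘(ℝ, E)) (G := G) t (X : GroupLieAlgebra 𝓘(ℝ, E) G)
  exact (congrArg (IsMIntegralCurve (I := 𝓘(ℝ, E)) _) e).mpr
    ((isMIntegralCurve_expCurve (G := G) X).comp_mul t)

lemma IsExp.eq_expCurve {X : E} {g : G} (h : IsExp (E := E) X g) : g = expCurve X 1 := by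
  obtain ⟨γ, h1, h2, rfl⟩ := h
  rw [isMIntegralCurve_eq_of_apply_zero_eq X h1 (isMIntegralCurve_expCurve X) (by simp [h2])]

variable [IsTopologicalGroup G]

lemma hasDerivAt_inv_mul_expCurve (X : E) (t : ℝ) :
    HasDerivAt (fun s => (toChart ((expCurve X t : G)⁻¹ * expCurve X s) : E)) X t :=
  (hasMFDerivAt_curve_iff.1 (isMIntegralCurve_expCurve (G := G) X t)).2

lemma continuous_expCurve (X : E) : Continuous (expCurve X : ℝ → G) :=
  (isMIntegralCurve_expCurve X).continuous

lemma expCurve_add (X : E) (s t : ℝ) : (expCurve X (s + t) : G) = expCurve X s * expCurve X t := by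
  have h1 := (isMIntegralCurve_expCurve (G := G) X).comp_add s
  have h2 : IsMIntegralCurve (I := 𝓘(ℝ, E)) (fun t => (expCurve X s * expCurve X t : G))
      (mulInvariantVectorField (X : GroupLieAlgebra 𝓘(ℝ, E) G)) := fun t => by
    refine hasMFDerivAt_curve_iff.2 ⟨continuousAt_const.mul (continuous_expCurve X).continuousAt, ?_⟩
    refine (hasDerivAt_inv_mul_expCurve (G := G) X t).congr_of_eventuallyEq
      (Eventually.of_forall fun r => ?_)
    simp only
    congr 1
    group
  have h3 := congrFun (isMIntegralCurve_eq_of_apply_zero_eq X h1 h2 (by simp)) t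
  simpa [add_comm] using h3

lemma expCurve_neg (X : E) (t : ℝ) : (expCurve X (-t) : G) = (expCurve X t)⁻¹ := by
  rw [eq_inv_iff_mul_eq_one, ← expCurve_add, neg_add_cancel, expCurve_zero]

/-- Strictness, needed for the inverse function theorem, comes at `0` from the continuity of the
derivative nearby, and elsewhere from the one-parameter group law. -/
lemma hasLeftDeriv_expCurve (X : E) (t : ℝ) :
    HasLeftDeriv (expCurve X : ℝ → G) (ContinuousLinearMap.toSpanSingleton ℝ X) t := by
  have hc := continuous_expCurve (G := G) X
  refine ⟨hc.continuousAt, ?_⟩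
  have ht : Tendsto (expCurve X : ℝ → G) (𝓝 0) (𝓝 1) := by
    simpa using hc.tendsto 0
  have h0 : ∀ᶠ s in 𝓝 (0 : ℝ), HasDerivAt (fun s => (toChart (expCurve X s : G) : E))
      (chartFrame E G (toChart (expCurve X s : G)) X) s := by
    filter_upwards [ht.eventually (eventually_ofChart_toChart (E := E) (G := G)),
      ht.eventually (tendsto_toChart.eventually
        (eventually_hasStrictFDerivAt_chartMul_right (E := E) (G := G)))] with s h1 h2
    have h3 := HasFDerivAt.comp_hasDerivAt_of_eq s h2.hasFDerivAt
      (hasDerivAt_inv_mul_expCurve (G := G) X s) (by simp)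
    refine h3.congr_of_eventuallyEq ?_
    filter_upwards [(tendsto_inv_mul hc.continuousAt).eventually
      (eventually_ofChart_toChart (E := E) (G := G))] with r e1
    simp [chartMul, e1, h1]
  have h1 : HasStrictDerivAt (fun s => (toChart (expCurve X s : G) : E)) X 0 := by
    have := hasStrictDerivAt_of_hasDerivAt_of_continuousAt h0 (by
      refine ContinuousAt.clm_apply (ContinuousAt.comp (g := chartFrame E G) ?_ ?_) continuousAt_const
      · simpa using continuousAt_chartFrame (E := E) (G := G)
      · exact ContinuousAt.comp (g := (toChart : G → E)) (by
          simpa using continuousAt_toChart_one (E := E) (G := G)) hc.continuousAt)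
    simpa [chartFrame_origin] using this
  have h2 : HasStrictDerivAt (fun s => (toChart (expCurve X (s - t) : G) : E)) X t := by
    have h3 := HasStrictDerivAt.scomp t (g₁ := fun s => (toChart (expCurve X s : G) : E))
      (h := fun s => s - t) (by simpa using h1) ((hasStrictDerivAt_id t).sub_const t)
    simpa [Function.comp_def] using h3
  refine HasStrictFDerivAt.congr_of_eventuallyEq h2.hasStrictFDerivAt
    (Eventually.of_forall fun s => ?_)
  simp only
  rw [← expCurve_neg, ← expCurve_add, neg_add_eq_sub]

lemma map_expCurve {A : G → G} (hA : ContMDiff 𝓘(ℝ, E) 𝓘(ℝ, E) ∞ A)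
    (hmul : ∀ g h, A (g * h) = A g * A h) (X : E) (t : ℝ) :
    A (expCurve X t) = expCurve (chartDeriv A X) t := by
  refine congrFun (isMIntegralCurve_eq_of_apply_zero_eq (γ := fun t => A (expCurve X t))
    (chartDeriv A X) (isMIntegralCurve_of_hasLeftDeriv fun t => ?_)
    (isMIntegralCurve_expCurve _) ?_) t
  · convert (hasLeftDeriv_expCurve (G := G) X t).map hA hmul using 1
    ext; simp
  · simpa using hmul 1 1

/-! ### The adjoint action along one-parameter subgroups -/

@[simp] lemma chartBracket_self (X : E) : chartBracket E G X X = 0 := by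
  simp [chartBracket]

lemma hasDerivAt_Ad_expCurve (X w : E) (t : ℝ) :
    HasDerivAt (fun s => Ad (expCurve X s : G) w) (chartBracket E G X (Ad (expCurve X t : G) w)) t := by
  have h0 : ∀ u : E, HasDerivAt (fun s => Ad (expCurve X s : G) u) (chartBracket E G X u) 0 := by
    intro u
    have h1 : HasDerivAt (fun s => (toChart (expCurve X s : G) : E)) X 0 := by
      simpa using hasDerivAt_inv_mul_expCurve (G := G) X 0
    have h2 := HasFDerivAt.comp_hasDerivAt_of_eq 0 (hasFDerivAt_Ad (G := G) u) h1 (by simp)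
    refine h2.congr_of_eventuallyEq ?_
    have ht : Tendsto (expCurve X : ℝ → G) (𝓝 0) (𝓝 1) := by
      simpa using (continuous_expCurve (G := G) X).tendsto 0
    filter_upwards [ht.eventually (eventually_ofChart_toChart (E := E) (G := G))] with s hs
    simp [hs]
  have h3 := HasDerivAt.scomp t (g₁ := fun s => Ad (expCurve X s : G) (Ad (expCurve X t : G) w))
    (h := fun s => s - t) (by simpa using h0 (Ad (expCurve X t : G) w))
    ((hasDerivAt_id t).sub_const t)
  simp only [one_smul] at h3
  refine h3.congr_of_eventuallyEq (Eventually.of_forall fun s => ?_)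
  simp only [Function.comp]
  rw [← ContinuousLinearMap.comp_apply, ← Ad_mul, ← expCurve_add, sub_add_cancel]

lemma Ad_expCurve (X : E) (t : ℝ) :
    (Ad (expCurve X t : G) : E →L[ℝ] E) = NormedSpace.exp (t • chartBracket E G X) := by
  have : CompleteSpace E := FiniteDimensional.complete ℝ E
  let _ : NormedAlgebra ℚ (E →L[ℝ] E) := NormedAlgebra.restrictScalars ℚ ℝ _
  set B : E →L[ℝ] E := chartBracket E G X with hB
  have hcomm : ∀ s : ℝ, NormedSpace.exp (s • B) * NormedSpace.exp (s • (-B)) = 1 := fun s => by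
    rw [← NormedSpace.exp_add_of_commute (((Commute.refl B).neg_right.smul_left s).smul_right s)]
    simp
  ext w
  -- The curve `Ad (exp sX) w` solves `y' = [X, y]`, so `exp (-s ad X)` applied to it is constant.
  have hd : ∀ s, HasDerivAt (fun s => NormedSpace.exp (s • (-B)) (Ad (expCurve X s : G) w)) 0 s := by
    intro s
    have h1 := (hasDerivAt_exp_smul_const (𝕂 := ℝ) (-B) s).clm_apply
      (hasDerivAt_Ad_expCurve (G := G) X w s)
    convert h1 using 1
    simp [hB]
  have h2 := is_const_of_deriv_eq_zero (fun s => (hd s).differentiableAt) (fun s => (hd s).deriv) t 0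
  simp only [expCurve_zero, Ad_one, zero_smul, NormedSpace.exp_zero] at h2
  have h3 := congrArg (NormedSpace.exp (t • B) : E →L[ℝ] E) h2
  rw [← mul_apply_eq_comp, hcomm] at h3
  simpa using h3

lemma continuous_Ad_expCurve (X : E) : Continuous fun t => (Ad (expCurve X t : G) : E →L[ℝ] E) := by
  have : CompleteSpace E := FiniteDimensional.complete ℝ E
  let _ : NormedAlgebra ℚ (E →L[ℝ] E) := NormedAlgebra.restrictScalars ℚ ℝ _
  simp_rw [Ad_expCurve]
  exact NormedSpace.exp_continuous.comp (continuous_id.smul continuous_const)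

lemma exp_apply_mem {W : Submodule ℝ E} {T : E →L[ℝ] E} (hT : ∀ w ∈ W, T w ∈ W) {w : E}
    (hw : w ∈ W) : NormedSpace.exp T w ∈ W := by
  have : CompleteSpace E := FiniteDimensional.complete ℝ E
  have h1 := (NormedSpace.exp_series_hasSum_exp' (𝕂 := ℝ) T).mapL (ContinuousLinearMap.apply ℝ E w)
  refine W.closed_of_finiteDimensional.mem_of_tendsto h1
    (Eventually.of_forall fun s => W.sum_mem fun n _ => ?_)
  have h2 : ∀ n : ℕ, (T ^ n) w ∈ W := fun n => by
    induction n with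
    | zero => simpa
    | succ n ih => rw [pow_succ', mul_apply_eq_comp]; exact hT _ ih
  simpa using W.smul_mem _ (h2 n)

lemma Ad_expCurve_mem {W : Submodule ℝ E} {X : E} (hX : ∀ w ∈ W, chartBracket E G X w ∈ W) {w : E}
    (hw : w ∈ W) (t : ℝ) : Ad (expCurve X t : G) w ∈ W := by
  rw [Ad_expCurve]
  exact exp_apply_mem (fun w hw => by simpa using W.smul_mem t (hX w hw)) hw

/-- Conjugation by `exp (tX)` fixes the one-parameter subgroup of `X` pointwise, hence its velocity.
-/
lemma Ad_expCurve_self (X : E) (t : ℝ) : Ad (expCurve X t : G) X = X := by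
  have h := map_expCurve (contMDiff_conj (E := E) (expCurve X t : G)) (fun g h => by group) X
  have h1 : (expCurve (Ad (expCurve X t : G) X) : ℝ → G) = expCurve X := by
    funext s
    rw [Ad, ← h s, ← expCurve_add, ← expCurve_neg, ← expCurve_add]
    congr 1; ring
  have h2 := hasDerivAt_inv_mul_expCurve (G := G) (Ad (expCurve X t : G) X) 0
  rw [h1] at h2
  exact h2.unique (hasDerivAt_inv_mul_expCurve X 0)

/-- Derivative at `s = 0` of `dA (Ad (exp sX) w) = Ad (A (exp sX)) (dA w)`. -/
lemma chartDeriv_chartBracket {A : G → G} (hA : ContMDiff 𝓘(ℝ, E) 𝓘(ℝ, E) ∞ A)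
    (hmul : ∀ g h, A (g * h) = A g * A h) (X w : E) :
    chartDeriv A (chartBracket E G X w) = chartBracket E G (chartDeriv A X) (chartDeriv A w) := by
  have hA1 : A 1 = 1 := by simpa using hmul 1 1
  have hinv : ∀ g, A g⁻¹ = (A g)⁻¹ := fun g => by
    rw [eq_inv_iff_mul_eq_one, ← hmul, inv_mul_cancel, hA1]
  have key : ∀ g : G, chartDeriv A (Ad g w) = Ad (A g) (chartDeriv A w) := by
    intro g
    rw [Ad, Ad, ← ContinuousLinearMap.comp_apply, ← ContinuousLinearMap.comp_apply,
      ← chartDeriv_comp hA.contMDiffAt (contMDiff_conj g).contMDiffAt hA1 (by simp),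
      ← chartDeriv_comp (contMDiff_conj _).contMDiffAt hA.contMDiffAt (by simp) hA1]
    congr 2
    funext x
    simp [hmul, hinv]
  have h1 := (chartDeriv A : E →L[ℝ] E).hasFDerivAt.comp_hasDerivAt 0
    (hasDerivAt_Ad_expCurve (G := G) X w 0)
  have h2 := hasDerivAt_Ad_expCurve (G := G) (chartDeriv A X) (chartDeriv A w) 0
  have h3 : (chartDeriv A : E →L[ℝ] E) ∘ (fun s => Ad (expCurve X s : G) w) =
      fun s => Ad (expCurve (chartDeriv A X) s : G) (chartDeriv A w) := by
    funext s
    rw [Function.comp, key, map_expCurve hA hmul]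
  rw [h3] at h1
  simpa [Ad_one] using h1.unique h2

/-! ### Nilpotency -/

variable (E G) in
/-- The upper central series of the Lie algebra. -/
def bracketLevel : ℕ → Submodule ℝ E
  | 0 => ⊥
  | n + 1 => ⨅ X : E, (bracketLevel n).comap (chartBracket E G X : E →ₗ[ℝ] E)

lemma mem_bracketLevel_succ {n : ℕ} {w : E} :
    w ∈ bracketLevel E G (n + 1) ↔ ∀ X, chartBracket E G X w ∈ bracketLevel E G n := by
  simp [bracketLevel, Submodule.mem_iInf]

variable (E G) in
/-- The upper central series of the adjoint action. -/
def adLevel : ℕ → Submodule ℝ E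
  | 0 => ⊥
  | n + 1 => ⨅ g : G, (adLevel n).comap (Ad g - ContinuousLinearMap.id ℝ E : E →L[ℝ] E).toLinearMap

lemma mem_adLevel_succ {n : ℕ} {w : E} :
    w ∈ adLevel E G (n + 1) ↔ ∀ g : G, Ad g w - w ∈ adLevel E G n := by
  simp [adLevel, Submodule.mem_iInf]

/-- The bracket `[X, w]` is a limit of difference quotients of `Ad (exp tX) w`, which lie in the
closed subspace `adLevel n`. -/
lemma adLevel_le_bracketLevel (n : ℕ) : adLevel E G n ≤ bracketLevel E G n := by
  induction n with
  | zero => exact le_rfl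
  | succ n ih =>
    intro w hw
    refine mem_bracketLevel_succ.2 fun X => ih ?_
    have h := hasDerivAt_Ad_expCurve (G := G) X w 0
    simp only [expCurve_zero, Ad_one, ContinuousLinearMap.id_apply] at h
    refine (adLevel E G n).closed_of_finiteDimensional.mem_of_tendsto
      (hasDerivAt_iff_tendsto_slope_zero.1 h) (Eventually.of_forall fun t => ?_)
    refine Submodule.smul_mem _ _ ?_
    simpa [Ad_one] using mem_adLevel_succ.1 hw (expCurve X t)

lemma hasLeftDeriv_comp_ofChart {f : G → G} (hf : ContMDiffAt 𝓘(ℝ, E) 𝓘(ℝ, E) ∞ f 1)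
    (h1 : f 1 = 1) : HasLeftDeriv (fun x : E => f (ofChart x)) (chartDeriv f : E →L[ℝ] E)
      (origin E G) := by
  refine ⟨ContinuousAt.comp (g := f) (by simpa using hf.continuousAt) continuousAt_ofChart_origin, ?_⟩
  simpa [h1] using hasStrictFDerivAt_chartDeriv hf h1

/-- Transfers nilpotency from group to Lie algebra, in the end with `f = id`. A general `f` makes
the induction run: `x ↦ [g, f x]` takes values one level lower in the central series and has
derivative `(Ad g - 1) ∘ df`. -/
lemma chartDeriv_mem_adLevel (n : ℕ) {f : G → G} (hf : ContMDiffAt 𝓘(ℝ, E) 𝓘(ℝ, E) ∞ f 1)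
    (h1 : f 1 = 1) (hn : ∀ g, f g ∈ Subgroup.upperCentralSeries G n) (w : E) :
    chartDeriv f w ∈ adLevel E G n := by
  induction n generalizing f with
  | zero =>
    have : f = fun _ => 1 := by funext g; simpa using hn g
    subst this
    have h0 : (chartDeriv (fun _ : G => (1 : G)) : E →L[ℝ] E) = 0 := by simp [chartDeriv]
    simp [h0]
  | succ n ih =>
    refine mem_adLevel_succ.2 fun g => ?_
    have hK : ContMDiff 𝓘(ℝ, E) 𝓘(ℝ, E) ∞ fun h : G => g * h * g⁻¹ * h⁻¹ :=
      (contMDiff_conj g).mul contMDiff_id.inv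
    have hKd : (chartDeriv fun h : G => g * h * g⁻¹ * h⁻¹) = Ad g - ContinuousLinearMap.id ℝ E := by
      have h2 := (hasLeftDeriv_comp_ofChart hK.contMDiffAt (by simp)).mul
        (hasLeftDeriv_comp_ofChart (E := E) (f := fun h : G => h) contMDiff_id.contMDiffAt rfl)
      have h3 := hasLeftDeriv_comp_ofChart (contMDiff_conj (E := E) g).contMDiffAt (by simp)
      have h4 := h2.unique (by simpa using h3)
      have h5 : (chartDeriv fun h : G => h) = ContinuousLinearMap.id ℝ E := chartDeriv_id
      simp only [ofChart_origin, inv_one, Ad_one, h5, ContinuousLinearMap.id_comp] at h4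
      rw [Ad, ← h4, add_sub_cancel_right]
    have h2 := ih (f := (fun h : G => g * h * g⁻¹ * h⁻¹) ∘ f)
      (ContMDiffAt.comp 1 hK.contMDiffAt hf) (by simp [h1]) (fun x => by
        have := inv_mem (Subgroup.mem_upperCentralSeries_succ_iff.1 (hn x) g)
        simpa [commutatorElement_def, mul_assoc] using this)
    rw [chartDeriv_comp hK.contMDiffAt hf (by simp) h1, hKd] at h2
    simpa using h2

lemma exists_bracketLevel_eq_top [Group.IsNilpotent G] : ∃ n, bracketLevel E G n = ⊤ := by
  obtain ⟨n, hn⟩ := Group.IsNilpotent.nilpotent G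
  refine ⟨n, eq_top_iff.2 fun w _ => adLevel_le_bracketLevel n ?_⟩
  have := chartDeriv_mem_adLevel (E := E) n (f := (id : G → G)) contMDiff_id.contMDiffAt rfl
    (fun g => by rw [hn]; trivial) w
  simpa [chartDeriv_id] using this

end ExpCurve

end NilAnosov

namespace NilAnosov

open Filter Topology Set

/-! ### Coordinates of the second kind and factorization of subgroups. -/

section Coordinates

variable {E : Type*} [NormedAddCommGroup E] [NormedSpace ℝ E] [FiniteDimensional ℝ E]
  {G : Type*} [TopologicalSpace G] [T2Space G] [ChartedSpace E G] [Group G]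
  [LieGroup 𝓘(ℝ, E) ∞ G] [IsTopologicalGroup G]

variable (G) in
/-- The subgroup of `G` generated by the exponentials of the elements of `W`. -/
def expSubgroup (W : Submodule ℝ E) : Subgroup G :=
  Subgroup.closure {g : G | ∃ X ∈ W, g = expCurve X 1}

lemma expCurve_one_smul (X : E) (t : ℝ) : (expCurve (t • X) 1 : G) = expCurve X t :=
  (isExp_expCurve (G := G) X t).eq_expCurve.symm

lemma expCurve_mem_expSubgroup {W : Submodule ℝ E} {X : E} (hX : X ∈ W) (t : ℝ) :
    expCurve X t ∈ expSubgroup G W :=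
  Subgroup.subset_closure ⟨t • X, W.smul_mem t hX, (expCurve_one_smul X t).symm⟩

lemma expSubgroup_mono {W W' : Submodule ℝ E} (h : W ≤ W') : expSubgroup G W ≤ expSubgroup G W' :=
  Subgroup.closure_mono fun _ ⟨X, hX, e⟩ => ⟨X, h hX, e⟩

/-- `Φ : V → G` is a system of coordinates (of the second kind) on the connected subgroup with Lie
algebra `W`: an immersion tangent to `W`, such that `C¹` curves tangent to `W` lift through `Φ`. -/
structure IsCoordinates {V : Type*} [NormedAddCommGroup V] [NormedSpace ℝ V] (Φ : V → G)
    (W : Submodule ℝ E) : Prop where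
  map_zero : Φ 0 = 1
  exists_deriv : ∃ D : V → V →L[ℝ] E, Continuous D ∧ ∀ v, HasLeftDeriv Φ (D v) v ∧
    Function.Injective (D v) ∧ ∀ u, D v u ∈ W
  finrank_eq : Module.finrank ℝ V = Module.finrank ℝ W
  exists_lift : ∀ (c : ℝ → G) (η : ℝ → E), Continuous η → (∀ t, η t ∈ W) →
    (∀ t, HasLeftDeriv c (ContinuousLinearMap.toSpanSingleton ℝ (η t)) t) →
    ∀ v, Φ v = c 0 → ∃ z : ℝ → V, Continuous z ∧ z 0 = v ∧ ∀ t, Φ (z t) = c t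
  mem_expSubgroup : ∀ v, Φ v ∈ expSubgroup G W

namespace IsCoordinates

lemma trivial : IsCoordinates (fun _ : Fin 0 → ℝ => (1 : G)) (⊥ : Submodule ℝ E) where
  map_zero := rfl
  exists_deriv := ⟨fun _ => 0, continuous_const, fun v => ⟨HasLeftDeriv.const 1,
    Function.injective_of_subsingleton _, fun _ => by simp⟩⟩
  finrank_eq := by simp
  exists_lift c η _ hη hc v hv := by
    refine ⟨fun _ => v, continuous_const, rfl, fun t => ?_⟩
    simp only [Submodule.mem_bot] at hη
    rw [hv]
    refine eq_of_hasLeftDeriv_zero (E := E) (fun t => ?_) 0 t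
    simpa [hη] using hc t
  mem_expSubgroup _ := one_mem _

variable {V : Type*} [NormedAddCommGroup V] [NormedSpace ℝ V] [FiniteDimensional ℝ V] {Φ : V → G}
  {W : Submodule ℝ E}

/-- Adds one normalizing direction. Normalization makes `Ad (exp tX)` preserve `W`; with `X ∉ W`
this gives the immersion property, and it keeps a curve tangent to `W` after its `X`-part is divided
off. -/
lemma mul_expCurve (h : IsCoordinates Φ W) {X : E} (hX : ∀ w ∈ W, chartBracket E G X w ∈ W)
    (hXW : X ∉ W) :
    IsCoordinates (fun p : V × ℝ => Φ p.1 * expCurve X p.2) (W ⊔ Submodule.span ℝ {X}) where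
  map_zero := by simp [h.map_zero]
  exists_deriv := by
    obtain ⟨D, hDc, hD⟩ := h.exists_deriv
    refine ⟨fun p => (Ad (expCurve X (-p.2) : G)).comp ((D p.1).comp (ContinuousLinearMap.fst ℝ V ℝ))
      + (ContinuousLinearMap.toSpanSingleton ℝ X).comp (ContinuousLinearMap.snd ℝ V ℝ), ?_,
      fun p => ⟨?_, ?_, ?_⟩⟩
    · have h1 := (continuous_Ad_expCurve (G := G) X).comp (continuous_snd (X := V) (Y := ℝ)).neg
      exact (h1.clm_comp ((hDc.comp continuous_fst).clm_comp continuous_const)).add continuous_const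
    · have h1 := HasLeftDeriv.mul ((hD p.1).1.comp (f := Prod.fst) (u := p) hasStrictFDerivAt_fst)
        ((hasLeftDeriv_expCurve (G := G) X p.2).comp (f := Prod.snd) (u := p) hasStrictFDerivAt_snd)
      rwa [← expCurve_neg] at h1
    · refine (injective_iff_map_eq_zero _).2 fun u hu => ?_
      simp only [add_apply, ContinuousLinearMap.comp_apply, ContinuousLinearMap.coe_fst',
        ContinuousLinearMap.coe_snd', ContinuousLinearMap.toSpanSingleton_apply] at hu
      have h1 : Ad (expCurve X (-p.2) : G) (D p.1 u.1) ∈ W :=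
        Ad_expCurve_mem hX ((hD p.1).2.2 u.1) _
      have h2 : u.2 = 0 := by
        by_contra h2
        refine hXW ((W.smul_mem_iff h2).1 ?_)
        rw [← neg_eq_of_add_eq_zero_right hu]
        exact W.neg_mem h1
      rw [h2, zero_smul, add_zero] at hu
      have h3 := congrArg (Ad (expCurve X p.2 : G)) hu
      rw [← ContinuousLinearMap.comp_apply, ← Ad_mul, ← expCurve_add, add_neg_cancel, expCurve_zero,
        Ad_one, _root_.map_zero] at h3
      have h4 : u.1 = 0 := (injective_iff_map_eq_zero _).1 (hD p.1).2.1 _ h3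
      exact Prod.ext h4 h2
    · intro u
      exact Submodule.add_mem_sup (Ad_expCurve_mem hX ((hD p.1).2.2 u.1) _)
        (Submodule.mem_span_singleton.2 ⟨u.2, by simp⟩)
  finrank_eq := by
    have h1 := Submodule.finrank_sup_add_finrank_inf_eq W (Submodule.span ℝ {X})
    have h2 : W ⊓ Submodule.span ℝ {X} = ⊥ :=
      ((Submodule.disjoint_span_singleton' (by rintro rfl; exact hXW W.zero_mem)).2 hXW).eq_bot
    rw [h2, finrank_bot, add_zero,
      finrank_span_singleton (by rintro rfl; exact hXW W.zero_mem)] at h1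
    rw [Module.finrank_prod, h.finrank_eq, Module.finrank_self, h1]
  exists_lift c η hηc hη hc v hv := by
    -- The functional `ℓ` vanishes on `W` but not at `X`, so `b t` is the `X`-coefficient of `η t`.
    -- Its primitive `β` will be the last coordinate of the lift.
    obtain ⟨ℓ, hℓX, hℓW⟩ := Submodule.exists_le_ker_of_notMem hXW
    set b : ℝ → ℝ := fun t => (ℓ X)⁻¹ * ℓ (η t) with hb
    have hbc : Continuous b :=
      continuous_const.mul (ℓ.continuous_of_finiteDimensional.comp hηc)
    have hy : ∀ t, η t - b t • X ∈ W := by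
      intro t
      obtain ⟨w, hw, x, hx, e⟩ := Submodule.mem_sup.1 (hη t)
      obtain ⟨r, rfl⟩ := Submodule.mem_span_singleton.1 hx
      have : ℓ w = 0 := hℓW hw
      have : b t = r := by simp [hb, ← e, this]; field_simp
      rw [this, ← e, add_sub_cancel_right]
      exact hw
    set β : ℝ → ℝ := fun t => v.2 + ∫ s in (0 : ℝ)..t, b s with hβ
    have hβd : ∀ t, HasStrictDerivAt β (b t) t := fun t =>
      (intervalIntegral.integral_hasStrictDerivAt_right (hbc.intervalIntegrable _ _)
        (hbc.stronglyMeasurableAtFilter _ _) hbc.continuousAt).const_add v.2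
    have hβc : Continuous β := continuous_iff_continuousAt.2 fun t => (hβd t).hasDerivAt.continuousAt
    -- The product rule gives `Ad (exp βX) η - b X`. As `Ad (exp βX)` fixes `X`, this is the image
    -- of `η - b X ∈ W`, so the hypothesis on `Φ` lifts the corrected curve.
    have hc' : ∀ t, HasLeftDeriv (fun t => c t * expCurve X (-β t))
        (ContinuousLinearMap.toSpanSingleton ℝ (Ad (expCurve X (β t) : G) (η t - b t • X))) t := by
      intro t
      have h1 := (hc t).mul ((hasLeftDeriv_expCurve (G := G) X (-β t)).comp (f := fun t => -β t)
        (u := t) (hβd t).neg.hasStrictFDerivAt)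
      convert h1 using 1
      ext
      simp [← expCurve_neg, Ad_expCurve_self, sub_eq_add_neg]
    obtain ⟨z, hzc, hz0, hz⟩ := h.exists_lift _ _
      (((continuous_Ad_expCurve (G := G) X).comp hβc).clm_apply (hηc.sub (hbc.smul continuous_const)))
      (fun t => Ad_expCurve_mem hX (hy t) _) hc' v.1 (by
        rw [← hv, expCurve_neg]; simp [hβ])
    refine ⟨fun t => (z t, β t), hzc.prodMk hβc, Prod.ext hz0 (by simp [hβ]), fun t => ?_⟩
    simp [hz, expCurve_neg]
  mem_expSubgroup p := mul_mem (expSubgroup_mono le_sup_left (h.mem_expSubgroup _))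
    (expCurve_mem_expSubgroup (Submodule.mem_sup_right (Submodule.mem_span_singleton_self X)) _)

/-- The curve `t ↦ Φ v * exp (tX)` with `X ∈ W` is tangent to `W`, so it lifts; thus the range is
stable under right multiplication by the generators and their inverses. -/
lemma range_eq (h : IsCoordinates Φ W) : range Φ = expSubgroup G W := by
  refine Subset.antisymm (range_subset_iff.2 h.mem_expSubgroup) fun g hg => ?_
  have key : ∀ x ∈ range Φ, ∀ X ∈ W, ∀ t, x * expCurve X t ∈ range Φ := by
    rintro _ ⟨v, rfl⟩ X hX t
    obtain ⟨z, -, -, hz⟩ := h.exists_lift (fun t => Φ v * expCurve X t) (fun _ => X)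
      continuous_const (fun _ => hX) (fun t => (hasLeftDeriv_expCurve X t).inv_apply_congr) v
      (by simp)
    exact ⟨z t, hz t⟩
  induction hg using Subgroup.closure_induction_right with
  | one => exact ⟨0, h.map_zero⟩
  | mul_right x _ y hy hx =>
    obtain ⟨X, hX, rfl⟩ := hy
    exact key x hx X hX 1
  | mul_inv_cancel x _ y hy hx =>
    obtain ⟨X, hX, rfl⟩ := hy
    rw [← expCurve_neg]
    exact key x hx X hX _

end IsCoordinates

variable (G) in
/-- `W` is closed under the bracket. -/
def IsSubalgebra (W : Submodule ℝ E) : Prop := ∀ v ∈ W, ∀ w ∈ W, chartBracket E G v w ∈ W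

lemma chartBracket_swap (v w : E) : chartBracket E G v w = -chartBracket E G w v := by
  simp [chartBracket]

/-- In a nilpotent Lie algebra, a proper subspace of a subalgebra is normalized by some element
outside of it. -/
lemma exists_notMem_normalizing [Group.IsNilpotent G] {h m : Submodule ℝ E} (hm : IsSubalgebra G m)
    (hle : h ≤ m) (hne : ¬ m ≤ h) : ∃ X ∈ m, X ∉ h ∧ ∀ w ∈ h, chartBracket E G X w ∈ h := by
  have hex : ∃ n, ¬ bracketLevel E G n ⊓ m ≤ h := by
    obtain ⟨n, hn⟩ := exists_bracketLevel_eq_top (E := E) (G := G)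
    exact ⟨n, by rwa [hn, top_inf_eq]⟩
  classical
  -- At the first level `n` of the upper central series with a vector of `m` outside `h`, brackets
  -- of that vector with `h` drop one level and so fall into `h`.
  obtain ⟨n, hn, hmin⟩ : ∃ n, ¬ bracketLevel E G n ⊓ m ≤ h ∧
      ∀ k < n, bracketLevel E G k ⊓ m ≤ h :=
    ⟨Nat.find hex, Nat.find_spec hex, fun k hk => not_not.1 (Nat.find_min hex hk)⟩
  cases n with
  | zero => exact absurd (by simp [bracketLevel]) hn
  | succ n =>
    obtain ⟨X, hX, hXh⟩ := SetLike.not_le_iff_exists.1 hn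
    refine ⟨X, hX.2, hXh, fun w hw => ?_⟩
    rw [chartBracket_swap]
    exact h.neg_mem (hmin n (Nat.lt_succ_self n)
      ⟨mem_bracketLevel_succ.1 hX.1 w, hm w (hle hw) X hX.2⟩)

lemma IsSubalgebra.sup_span_singleton {W : Submodule ℝ E} (hW : IsSubalgebra G W) {X : E}
    (hX : ∀ w ∈ W, chartBracket E G X w ∈ W) : IsSubalgebra G (W ⊔ Submodule.span ℝ {X}) := by
  intro v hv w hw
  obtain ⟨v, hv', x, hx, rfl⟩ := Submodule.mem_sup.1 hv
  obtain ⟨w, hw', y, hy, rfl⟩ := Submodule.mem_sup.1 hw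
  obtain ⟨r, rfl⟩ := Submodule.mem_span_singleton.1 hx
  obtain ⟨s, rfl⟩ := Submodule.mem_span_singleton.1 hy
  refine Submodule.mem_sup_left ?_
  have h1 : chartBracket E G v X ∈ W := by
    rw [chartBracket_swap]; exact W.neg_mem (hX v hv')
  simpa using W.add_mem (W.add_mem (hW v hv' w hw') (W.smul_mem s h1)) (W.smul_mem r (hX w hw'))

/-- Coordinates on the subgroups with Lie algebras `h ⊔ k` and `k`, compatible with given
coordinates on the subgroup with Lie algebra `h`. -/
def HasAdaptedCoordinates {V₀ : Type} [NormedAddCommGroup V₀] [NormedSpace ℝ V₀] (Φ₀ : V₀ → G)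
    (h k : Submodule ℝ E) : Prop :=
  ∃ (V V' : Type) (_ : NormedAddCommGroup V) (_ : NormedAddCommGroup V') (_ : NormedSpace ℝ V)
    (_ : NormedSpace ℝ V') (_ : FiniteDimensional ℝ V) (_ : FiniteDimensional ℝ V')
    (Φ : V → G) (Φ' : V' → G) (ι : V₀ → V) (ι' : V' → V),
    IsCoordinates Φ (h ⊔ k) ∧ IsCoordinates Φ' k ∧ (∀ a, Φ (ι a) = Φ₀ a) ∧
    (∀ b, Φ (ι' b) = Φ' b) ∧ (∀ a b, ι a = ι' b → a = 0) ∧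
    ∀ v, ∃ x ∈ expSubgroup G h, ∃ y ∈ expSubgroup G k, Φ v = x * y

lemma hasAdaptedCoordinates_bot {V₀ : Type} [NormedAddCommGroup V₀] [NormedSpace ℝ V₀]
    [FiniteDimensional ℝ V₀] {Φ₀ : V₀ → G} {h : Submodule ℝ E} (hΦ₀ : IsCoordinates Φ₀ h) :
    HasAdaptedCoordinates Φ₀ h ⊥ :=
  ⟨V₀, Fin 0 → ℝ, _, _, _, _, inferInstance, inferInstance, Φ₀, _, id, fun _ => 0, by simpa,
    IsCoordinates.trivial, fun _ => rfl, fun _ => hΦ₀.map_zero, fun _ _ e => e,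
    fun v => ⟨_, hΦ₀.mem_expSubgroup v, 1, one_mem _, by simp⟩⟩

lemma HasAdaptedCoordinates.sup_span_singleton {V₀ : Type} [NormedAddCommGroup V₀]
    [NormedSpace ℝ V₀] {Φ₀ : V₀ → G} {h k : Submodule ℝ E} (H : HasAdaptedCoordinates Φ₀ h k)
    {X : E} (hX : X ∉ h ⊔ k) (hXhk : ∀ w ∈ h ⊔ k, chartBracket E G X w ∈ h ⊔ k)
    (hXk : ∀ w ∈ k, chartBracket E G X w ∈ k) :
    HasAdaptedCoordinates Φ₀ h (k ⊔ Submodule.span ℝ {X}) := by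
  obtain ⟨V, V', _, _, _, _, _, _, Φ, Φ', ι, ι', hΦ, hΦ', e, e', hι, hmul⟩ := H
  refine ⟨V × ℝ, V' × ℝ, inferInstance, inferInstance, inferInstance, inferInstance, inferInstance,
    inferInstance, fun p => Φ p.1 * expCurve X p.2, fun p => Φ' p.1 * expCurve X p.2,
    fun a => (ι a, 0), fun p => (ι' p.1, p.2), ?_,
    hΦ'.mul_expCurve hXk (fun hk => hX (Submodule.mem_sup_right hk)), fun a => by simp [e],
    fun b => by simp [e'], fun a b hab => hι a b.1 (congrArg Prod.fst hab), fun p => ?_⟩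
  · rw [← sup_assoc]
    exact hΦ.mul_expCurve hXhk hX
  · obtain ⟨x, hx, y, hy, hxy⟩ := hmul p.1
    refine ⟨x, hx, y * expCurve X p.2, mul_mem (expSubgroup_mono le_sup_left hy)
      (expCurve_mem_expSubgroup (Submodule.mem_sup_right (Submodule.mem_span_singleton_self X)) _), ?_⟩
    simp only [hxy, mul_assoc]

/-- Climbs from `h` to `h ⊔ k` one dimension at a time, always adding a vector of `k`, so that the
same exponentials build coordinates on both `h ⊔ k'` and `k'`. -/
lemma hasAdaptedCoordinates_of_isSubalgebra [Group.IsNilpotent G] {V₀ : Type}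
    [NormedAddCommGroup V₀] [NormedSpace ℝ V₀] [FiniteDimensional ℝ V₀] {Φ₀ : V₀ → G}
    {h k : Submodule ℝ E} (hΦ₀ : IsCoordinates Φ₀ h) (hh : IsSubalgebra G h) (hk : IsSubalgebra G k)
    (hhk : IsSubalgebra G (h ⊔ k)) (hdisj : Disjoint h k) : HasAdaptedCoordinates Φ₀ h k := by
  have key : ∀ n : ℕ, ∃ k' ≤ k, HasAdaptedCoordinates Φ₀ h k' ∧ IsSubalgebra G (h ⊔ k') ∧
      (k' = k ∨ n ≤ Module.finrank ℝ k') := by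
    intro n
    induction n with
    | zero => exact ⟨⊥, bot_le, hasAdaptedCoordinates_bot hΦ₀, by simpa, Or.inr (Nat.zero_le _)⟩
    | succ n ih =>
      obtain ⟨k', hle, hA, hsub, hn⟩ := ih
      by_cases heq : k' = k
      · exact ⟨k', hle, hA, hsub, Or.inl heq⟩
      have hn := hn.resolve_left heq
      -- Modular law: `(h ⊔ k') ⊓ k = k'`, because `h` and `k` are disjoint.
      have hkey : ∀ w ∈ h ⊔ k', w ∈ k → w ∈ k' := by
        intro w hw hwk
        obtain ⟨a, ha, b, hb, rfl⟩ := Submodule.mem_sup.1 hw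
        have ha0 : a = 0 := Submodule.disjoint_def.1 hdisj a ha
          (by simpa using k.sub_mem hwk (hle hb))
        simpa [ha0] using hb
      have hnle : ¬ h ⊔ k ≤ h ⊔ k' := fun hc =>
        heq (le_antisymm hle fun w hw => hkey w (hc (Submodule.mem_sup_right hw)) hw)
      obtain ⟨Y, hY, hYn, hYb⟩ := exists_notMem_normalizing hhk (sup_le_sup_left hle h) hnle
      -- The normalizing vector need not lie in `k`. Subtracting its `h`-part `a` does no harm,
      -- since `h ⊔ k'` is a subalgebra containing `a`; by `hkey` the remainder `X` also normalizes
      -- `k'`.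
      obtain ⟨a, ha, X, hX, rfl⟩ := Submodule.mem_sup.1 hY
      have hXn : X ∉ h ⊔ k' := fun hc =>
        hYn (Submodule.add_mem _ (Submodule.mem_sup_left ha) hc)
      have hXb : ∀ w ∈ h ⊔ k', chartBracket E G X w ∈ h ⊔ k' := fun w hw => by
        simpa using Submodule.sub_mem _ (hYb w hw) (hsub a (Submodule.mem_sup_left ha) w hw)
      have hXk : ∀ w ∈ k', chartBracket E G X w ∈ k' := fun w hw =>
        hkey _ (hXb w (Submodule.mem_sup_right hw)) (hk X hX w (hle hw))
      have hXk' : X ∉ k' := fun hc => hXn (Submodule.mem_sup_right hc)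
      refine ⟨k' ⊔ Submodule.span ℝ {X}, sup_le hle (by simpa), hA.sup_span_singleton hXn hXb hXk,
        ?_, Or.inr ?_⟩
      · rw [← sup_assoc]
        exact hsub.sup_span_singleton hXb
      · have : k' < k' ⊔ Submodule.span ℝ {X} := lt_of_le_of_ne le_sup_left fun e => hXk' (by
          rw [e]; exact Submodule.mem_sup_right (Submodule.mem_span_singleton_self X))
        exact lt_of_le_of_lt hn (Submodule.finrank_lt_finrank_of_lt this)
  -- One more than the dimension of `k` excludes the second alternative, forcing `k' = k`.
  obtain ⟨k', hle, hA, -, hn⟩ := key (Module.finrank ℝ k + 1)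
  rcases hn with rfl | hn
  · exact hA
  · exact absurd (Submodule.finrank_mono hle) (by omega)

lemma isSubalgebra_bot : IsSubalgebra G (⊥ : Submodule ℝ E) := by
  intro v hv w _
  rw [Submodule.mem_bot] at hv
  simp [hv]

lemma exists_isCoordinates [Group.IsNilpotent G] {h : Submodule ℝ E} (hh : IsSubalgebra G h) :
    ∃ (V : Type) (_ : NormedAddCommGroup V) (_ : NormedSpace ℝ V) (_ : FiniteDimensional ℝ V)
      (Φ : V → G), IsCoordinates Φ h := by
  obtain ⟨_, V, _, _, _, _, _, _, _, Φ, _, _, -, hΦ, -⟩ := hasAdaptedCoordinates_of_isSubalgebra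
    (IsCoordinates.trivial (E := E) (G := G)) isSubalgebra_bot hh (by rwa [bot_sup_eq]) disjoint_bot_left
  exact ⟨V, _, _, inferInstance, Φ, hΦ⟩

/-- The product decomposition of the subgroup with Lie algebra `h ⊕ k`. -/
lemma exists_mul_eq_of_mem_expSubgroup_sup [Group.IsNilpotent G] {h k : Submodule ℝ E}
    (hh : IsSubalgebra G h) (hk : IsSubalgebra G k) (hhk : IsSubalgebra G (h ⊔ k))
    (hdisj : Disjoint h k) {g : G} (hg : g ∈ expSubgroup G (h ⊔ k)) :
    ∃ x ∈ expSubgroup G h, ∃ y ∈ expSubgroup G k, g = x * y := by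
  obtain ⟨V₀, _, _, _, Φ₀, hΦ₀⟩ := exists_isCoordinates hh
  obtain ⟨V, _, _, _, _, _, _, _, Φ, _, _, _, hΦ, -, -, -, -, hmul⟩ :=
    hasAdaptedCoordinates_of_isSubalgebra hΦ₀ hh hk hhk hdisj
  have : g ∈ range Φ := by rw [hΦ.range_eq]; exact hg
  obtain ⟨v, rfl⟩ := this
  exact hmul v

end Coordinates

end NilAnosov

namespace NilAnosov

open Filter Topology Set unitInterval

/-! ### Path lifting, monodromy and injectivity of global coordinates. -/

section Covering

/-- A local homeomorphism onto a neighbourhood of the identity that admits lifts of the translates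
lifts all paths. -/
lemma exists_path_lift_of_translations {V G : Type*} [TopologicalSpace V] [TopologicalSpace G]
    [Group G] [IsTopologicalGroup G] {Φ : V → G} {v₀ : V} {U : Set G} (hU : U ∈ 𝓝 (1 : G))
    {sec : G → V} (hsec : ContinuousOn sec U) (hsec1 : sec 1 = v₀) (hΦsec : ∀ u ∈ U, Φ (sec u) = u)
    (hμ : ∀ x : V, ∃ μ : V → V, Continuous μ ∧ μ v₀ = x ∧ ∀ y, Φ (μ y) = Φ x * Φ y)
    (γ : C(I, G)) (v : V) (hv : Φ v = γ 0) : ∃ Γ : C(I, V), Γ 0 = v ∧ ∀ t, Φ (Γ t) = γ t := by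
  have hdiv : Tendsto (fun p : G × G => p.1⁻¹ * p.2) (𝓝 (1, 1)) (𝓝 1) := by
    have : Continuous fun p : G × G => p.1⁻¹ * p.2 := by fun_prop
    simpa using this.tendsto (1, 1)
  obtain ⟨O₁, O₂, hO₁, h1O₁, hO₂, h1O₂, hOU⟩ := mem_nhds_prod_iff'.1 (hdiv hU)
  -- Subdivision of the interval such that, for two parameters in one piece, the quotient of the
  -- values of `γ` lies in `U`, the domain of the local section.
  obtain ⟨t, t_0, t_mono, ⟨n_max, h_max⟩, t_sub⟩ :=
    exists_monotone_Icc_subset_open_cover_unitInterval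
      (c := fun a : I => {s : I | (γ a)⁻¹ * γ s ∈ O₁ ∩ O₂})
      (fun a => (hO₁.inter hO₂).preimage (by fun_prop)) fun s _ => Set.mem_iUnion.2 ⟨s, by simpa using ⟨h1O₁, h1O₂⟩⟩
  suffices ∀ n, ∃ Γ : I → V, ContinuousOn Γ (Set.Icc 0 (t n)) ∧
      (∀ s ∈ Set.Icc 0 (t n), Φ (Γ s) = γ s) ∧ Γ 0 = v by
    obtain ⟨Γ, cont, eqOn, Γ_0⟩ := this n_max
    rw [h_max _ le_rfl] at cont eqOn
    have hI : Set.Icc (0 : I) 1 = univ := eq_univ_iff_forall.2 fun s => ⟨bot_le, le_top⟩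
    rw [hI] at cont eqOn
    exact ⟨⟨Γ, continuousOn_univ.mp cont⟩, Γ_0, fun s => eqOn s (mem_univ s)⟩
  intro n
  induction n with
  | zero =>
    refine ⟨fun _ => v, continuousOn_const, fun s hs => ?_, rfl⟩
    rw [t_0, Set.Icc_self, Set.mem_singleton_iff] at hs
    rw [hs, hv]
  | succ n ih =>
    obtain ⟨Γ, cont, eqOn, Γ_0⟩ := ih
    obtain ⟨a, ha⟩ := t_sub n
    -- The section near the identity, moved by the lifted translation `μ` from `v₀` to the current
    -- endpoint, continues the lift over the next piece.
    obtain ⟨μ, hμc, hμ0, hμ⟩ := hμ (Γ (t n))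
    have hΓn : Φ (Γ (t n)) = γ (t n) := eqOn _ ⟨t_0 ▸ t_mono n.zero_le, le_rfl⟩
    have hsub : ∀ s ∈ Set.Icc (t n) (t (n + 1)), (γ (t n))⁻¹ * γ s ∈ U := by
      intro s hs
      have h1 : (((γ a)⁻¹ * γ (t n))⁻¹ * ((γ a)⁻¹ * γ s)) ∈ U :=
        hOU (Set.mk_mem_prod (ha ⟨le_rfl, t_mono n.le_succ⟩).1 (ha hs).2)
      simpa [mul_assoc] using h1
    refine ⟨fun s => if s ≤ t n then Γ s else μ (sec ((γ (t n))⁻¹ * γ s)),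
      .if (fun s hs => ?_) (cont.mono fun _ h => ?_) ?_, fun s hs => ?_, ?_⟩
    · cases frontier_Iic_subset _ hs.2
      rw [inv_mul_cancel, hsec1, hμ0]
    · rw [closure_le_eq continuous_id' continuous_const] at h
      exact ⟨h.1.1, h.2⟩
    · refine hμc.comp_continuousOn (hsec.comp (by fun_prop) fun s hs => hsub s ?_)
      have h2 := hs.2
      simp_rw [not_le] at h2
      have h3 : t n ≤ s :=
        closure_lt_subset_le (f := fun _ : I => t n) (g := fun a : I => a) continuous_const
          continuous_id' h2
      exact ⟨h3, hs.1.2⟩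
    · dsimp only
      split_ifs with h
      · exact eqOn s ⟨hs.1, h⟩
      · rw [hμ, hΓn, hΦsec _ (hsub s ⟨le_of_not_ge h, hs.2⟩), mul_inv_cancel_left]
    · dsimp only
      rwa [if_pos (t_0 ▸ t_mono n.zero_le)]

/-- A separated local homeomorphism with path lifting from a path-connected space to a simply
connected space is injective. -/
lemma injective_of_path_lifting {V G : Type*} [TopologicalSpace V] [TopologicalSpace G]
    [T2Space V] [PathConnectedSpace V] [SimplyConnectedSpace G] {Φ : V → G}
    (hΦ : IsLocalHomeomorph Φ)
    (hlift : ∀ (γ : C(I, G)) (v : V), Φ v = γ 0 → ∃ Γ : C(I, V), Γ 0 = v ∧ ∀ t, Φ (Γ t) = γ t) :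
    Function.Injective Φ := by
  intro a b hab
  have sep : IsSeparatedMap Φ := T2Space.isSeparatedMap Φ
  let ℓ : Path a b := PathConnectedSpace.somePath a b
  let p : Path (Φ a) (Φ a) := (ℓ.map hΦ.continuous).cast rfl hab
  obtain ⟨H⟩ := SimplyConnectedSpace.paths_homotopic p (Path.refl (Φ a))
  choose Γ hΓ0 hΓ using fun t => hlift (H.toHomotopy.curry t) a (by simp)
  -- The loop `Φ ∘ ℓ` contracts to a point. All curves of the homotopy lift from `a` with the same
  -- endpoint; the first lift is `ℓ`, ending at `b`, and the last is constant.
  have h1 := hΦ.monodromy_theorem sep H Γ (fun t s => by simpa using hΓ t s)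
    (fun t => by rw [hΓ0, hΓ0]) 1
  have h2 : (Γ 0 : I → V) = ℓ := by
    refine sep.eq_of_comp_eq hΦ.isLocallyInjective (Γ 0).continuous ℓ.continuous ?_ 0
      (by rw [hΓ0, ℓ.source])
    funext s
    simpa [p] using hΓ 0 s
  have h3 : (Γ 1 : I → V) = fun _ => a := by
    refine sep.eq_of_comp_eq hΦ.isLocallyInjective (Γ 1).continuous continuous_const ?_ 0
      (by rw [hΓ0])
    funext s
    simpa using hΓ 1 s
  rw [h2, h3] at h1
  simpa using h1

variable {E : Type*} [NormedAddCommGroup E] [NormedSpace ℝ E] [FiniteDimensional ℝ E]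
  {G : Type*} [TopologicalSpace G] [T2Space G] [ChartedSpace E G] [Group G]
  [LieGroup 𝓘(ℝ, E) ∞ G] [IsTopologicalGroup G]
  {V : Type*} [NormedAddCommGroup V] [NormedSpace ℝ V] [FiniteDimensional ℝ V] {Φ : V → G}

namespace IsCoordinates

lemma continuous {W : Submodule ℝ E} (h : IsCoordinates Φ W) : Continuous Φ := by
  obtain ⟨D, -, hD⟩ := h.exists_deriv
  exact continuous_iff_continuousAt.2 fun v => (hD v).1.1

/-- An injective derivative between spaces of equal dimension is invertible, so the inverse function
theorem applies to `Φ` translated to the identity. Restricting to `S` keeps the chart invertible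
there. -/
lemma isLocalHomeomorph (h : IsCoordinates Φ (⊤ : Submodule ℝ E)) : IsLocalHomeomorph Φ := by
  have hc := h.continuous
  obtain ⟨D, -, hD⟩ := h.exists_deriv
  have : CompleteSpace V := FiniteDimensional.complete ℝ V
  refine IsLocalHomeomorph.mk Φ fun v => ?_
  have hfr : Module.finrank ℝ V = Module.finrank ℝ E := by rw [h.finrank_eq, finrank_top]
  let L : V ≃L[ℝ] E := (LinearEquiv.ofInjectiveOfFinrankEq (D v : V →ₗ[ℝ] E) (hD v).2.1
    hfr).toContinuousLinearEquiv
  have hL : (L : V →L[ℝ] E) = D v := by ext; rfl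
  have hs : HasStrictFDerivAt (fun w => (toChart ((Φ v)⁻¹ * Φ w) : E)) (L : V →L[ℝ] E) v := by
    rw [hL]; exact (hD v).1.2
  let e₁ := (hs.toOpenPartialHomeomorph _).trans ((chartAt E (1 : G)).symm.trans
    (Homeomorph.mulLeft (Φ v)).toOpenPartialHomeomorph)
  let S : Set V := {w | (Φ v)⁻¹ * Φ w ∈ (chartAt E (1 : G)).source}
  have hS : IsOpen S := (chartAt E (1 : G)).open_source.preimage (by fun_prop)
  refine ⟨e₁.restrOpen S hS, ⟨?_, ?_⟩, ?_⟩
  · simp only [e₁, OpenPartialHomeomorph.trans_source, mem_inter_iff, mem_preimage]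
    refine ⟨hs.mem_toOpenPartialHomeomorph_source, ?_, by simp⟩
    simp [toChart]
  · simp [S]
  · intro w hw
    have hw2 : w ∈ S := hw.2
    have h1 : (chartAt E (1 : G)).symm ((chartAt E (1 : G)) ((Φ v)⁻¹ * Φ w)) = (Φ v)⁻¹ * Φ w :=
      (chartAt E (1 : G)).left_inv hw2
    simp [e₁, toChart, h1]

/-- Left translation by `Φ x` lifts through global coordinates. -/
lemma exists_lift_mul_left (h : IsCoordinates Φ (⊤ : Submodule ℝ E)) (x : V) :
    ∃ μ : V → V, Continuous μ ∧ μ 0 = x ∧ ∀ y, Φ (μ y) = Φ x * Φ y := by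
  have hloc := h.isLocalHomeomorph
  have sep : IsSeparatedMap Φ := T2Space.isSeparatedMap Φ
  obtain ⟨D, hDc, hD⟩ := h.exists_deriv
  -- The translate by `Φ x` of the image of each ray `t ↦ t • y` is lifted; the endpoint at time one
  -- defines `μ y`.
  have hz : ∀ y : V, ∃ z : ℝ → V, Continuous z ∧ z 0 = x ∧ ∀ t, Φ (z t) = Φ x * Φ (t • y) := by
    intro y
    refine h.exists_lift (fun t => Φ x * Φ (t • y)) (fun t => D (t • y) y)
      ((hDc.comp (continuous_id.smul continuous_const)).clm_apply continuous_const)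
      (fun _ => Submodule.mem_top) (fun t => ?_) x (by simp [h.map_zero])
    have h1 := (hD (t • y)).1.comp (f := fun t : ℝ => t • y) (u := t)
      ((hasStrictDerivAt_id t).smul_const y).hasStrictFDerivAt
    convert (h1.inv_apply_congr (g := Φ x)) using 1
    ext; simp
  choose z hzc hz0 hz using hz
  let f : C(I × V, G) := ⟨fun p => Φ x * Φ ((p.1 : ℝ) • p.2), continuous_const.mul
    (h.continuous.comp ((continuous_subtype_val.comp continuous_fst).smul continuous_snd))⟩
  -- Lifts of a continuous family of paths through a separated local homeomorphism depend jointly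
  -- continuously on time and `y`.
  have hg := hloc.continuous_lift sep f (g := fun p => z p.2 p.1)
    (funext fun p => hz p.2 p.1) (by simpa [hz0] using continuous_const)
    (fun y => (hzc y).comp continuous_subtype_val)
  refine ⟨fun y => z y 1, hg.comp (Continuous.prodMk_right (1 : I)), ?_, fun y => by simp [hz]⟩
  show z 0 1 = x
  rw [sep.const_of_comp hloc.isLocallyInjective (hzc 0) (fun s t => by simp [hz]) 1 0, hz0]

lemma injective [SimplyConnectedSpace G] (h : IsCoordinates Φ (⊤ : Submodule ℝ E)) :
    Function.Injective Φ := by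
  have hloc := h.isLocalHomeomorph
  obtain ⟨e, he0, rfl⟩ := hloc 0
  refine injective_of_path_lifting hloc fun γ v hv =>
    exists_path_lift_of_translations (v₀ := (0 : V)) (U := e.target) (sec := e.symm) ?_
      e.continuousOn_symm ?_ (fun u hu => e.right_inv hu) h.exists_lift_mul_left γ v hv
  · rw [← h.map_zero]
    exact e.open_target.mem_nhds (e.map_source he0)
  · rw [← h.map_zero, e.left_inv he0]

end IsCoordinates

-- The subgroup is the range of an open map, and an open subgroup of a connected group is
-- everything.
variable (E G) in
lemma expSubgroup_top [ConnectedSpace G] [Group.IsNilpotent G] :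
    expSubgroup G (⊤ : Submodule ℝ E) = ⊤ := by
  obtain ⟨V, _, _, _, Φ, hΦ⟩ := exists_isCoordinates (G := G) (h := (⊤ : Submodule ℝ E))
    (fun _ _ _ _ => Submodule.mem_top)
  have h1 : IsOpen (expSubgroup G (⊤ : Submodule ℝ E) : Set G) := by
    rw [← hΦ.range_eq]
    exact hΦ.isLocalHomeomorph.isOpenMap.isOpen_range
  have h2 : IsClopen (expSubgroup G (⊤ : Submodule ℝ E) : Set G) :=
    ⟨Subgroup.isClosed_of_isOpen _ h1, h1⟩
  exact SetLike.coe_injective (h2.eq_univ ⟨1, one_mem _⟩)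

/-- A common element has coordinates `ι a` and `ι' b`; injectivity of the global `Φ` identifies
them, and adapted coordinates then force `a = 0`. -/
lemma eq_one_of_mem_expSubgroup [SimplyConnectedSpace G] [Group.IsNilpotent G]
    {h k : Submodule ℝ E} (hh : IsSubalgebra G h) (hk : IsSubalgebra G k) (hhk : IsCompl h k) {g : G}
    (hg : g ∈ expSubgroup G h) (hg' : g ∈ expSubgroup G k) : g = 1 := by
  obtain ⟨V₀, _, _, _, Φ₀, hΦ₀⟩ := exists_isCoordinates hh
  obtain ⟨V, V', _, _, _, _, _, _, Φ, Φ', ι, ι', hΦ, hΦ', e, e', hι, -⟩ :=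
    hasAdaptedCoordinates_of_isSubalgebra hΦ₀ hh hk
      (by rw [hhk.sup_eq_top]; exact fun _ _ _ _ => Submodule.mem_top) hhk.disjoint
  rw [hhk.sup_eq_top] at hΦ
  rw [← SetLike.mem_coe, ← hΦ₀.range_eq] at hg
  rw [← SetLike.mem_coe, ← hΦ'.range_eq] at hg'
  obtain ⟨a, rfl⟩ := hg
  obtain ⟨b, hb⟩ := hg'
  rw [hι a b (hΦ.injective (by rw [e, e', hb])), hΦ₀.map_zero]

end Covering

end NilAnosov

namespace NilAnosov

open Filter Topology Set

/-! ### Real spectral subspaces and their contraction properties. -/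

section Complexification

variable {V : Type*} [AddCommGroup V] [Module ℝ V]

variable (V) in
/-- Complex conjugation on the complexification. -/
def tensorConj : ℂ ⊗[ℝ] V →ₗ[ℝ] ℂ ⊗[ℝ] V := Complex.conjAe.toLinearMap.rTensor V

variable (V) in
/-- The real part on the complexification. -/
def tensorRe : ℂ ⊗[ℝ] V →ₗ[ℝ] V := (TensorProduct.lid ℝ V).toLinearMap ∘ₗ Complex.reLm.rTensor V

lemma tensorConj_smul (a : ℂ) (x : ℂ ⊗[ℝ] V) :
    tensorConj V (a • x) = (starRingEnd ℂ) a • tensorConj V x := by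
  induction x using TensorProduct.induction_on with
  | zero => simp
  | tmul b v => simp [tensorConj, TensorProduct.smul_tmul']
  | add x y hx hy => simp only [smul_add, map_add, hx, hy]

lemma tensorConj_baseChange (T : Module.End ℝ V) (x : ℂ ⊗[ℝ] V) :
    tensorConj V (T.baseChange ℂ x) = T.baseChange ℂ (tensorConj V x) := by
  induction x using TensorProduct.induction_on with
  | zero => simp
  | tmul b v => simp [tensorConj]
  | add x y hx hy => simp only [map_add, hx, hy]

lemma one_tmul_tensorRe (x : ℂ ⊗[ℝ] V) :
    (1 : ℂ) ⊗ₜ[ℝ] tensorRe V x = (1 / 2 : ℂ) • (x + tensorConj V x) := by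
  induction x using TensorProduct.induction_on with
  | zero => simp
  | tmul b v =>
    simp only [tensorRe, tensorConj, LinearMap.coe_comp, Function.comp_apply,
      LinearMap.rTensor_tmul, LinearEquiv.coe_coe, TensorProduct.lid_tmul, ← TensorProduct.add_tmul,
      TensorProduct.smul_tmul', ← TensorProduct.smul_tmul]
    congr 1
    apply Complex.ext
    · simp; ring
    · simp
  | add x y hx hy => rw [map_add, TensorProduct.tmul_add, hx, hy, map_add, ← smul_add]; congr 1; abel

lemma tensorConj_sub_smul_pow (T : Module.End ℝ V) (z : ℂ) (k : ℕ) (x : ℂ ⊗[ℝ] V) :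
    tensorConj V (((T.baseChange ℂ - z • (1 : Module.End ℂ (ℂ ⊗[ℝ] V))) ^ k) x) =
      ((T.baseChange ℂ - (starRingEnd ℂ) z • (1 : Module.End ℂ (ℂ ⊗[ℝ] V))) ^ k)
        (tensorConj V x) := by
  induction k generalizing x with
  | zero => simp
  | succ k ih =>
    rw [pow_succ, pow_succ, Module.End.mul_apply, Module.End.mul_apply, ih]
    simp [tensorConj_smul, tensorConj_baseChange]

/-- The complex spectral subspace of the complexification of `T`. -/
def complexSpectralSubspace (T : Module.End ℝ V) (S : Set ℝ) : Submodule ℂ (ℂ ⊗[ℝ] V) :=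
  ⨆ z : {z : ℂ // ‖z‖ ∈ S},
    Module.End.maxGenEigenspace (T.baseChange ℂ : Module.End ℂ (ℂ ⊗[ℝ] V)) z.1

lemma mem_spectralSubspace {T : Module.End ℝ V} {S : Set ℝ} {v : V} :
    v ∈ spectralSubspace T S ↔ (1 : ℂ) ⊗ₜ[ℝ] v ∈ complexSpectralSubspace T S := Iff.rfl

/-- Conjugation sends the generalized eigenspace of `z` to that of its conjugate, which has the same
modulus. Hence complex decompositions descend to real ones by taking real parts. -/
lemma tensorConj_mem {T : Module.End ℝ V} {S : Set ℝ} {x : ℂ ⊗[ℝ] V}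
    (hx : x ∈ complexSpectralSubspace T S) : tensorConj V x ∈ complexSpectralSubspace T S := by
  refine Submodule.iSup_induction _ (motive := fun x => tensorConj V x ∈ _) hx ?_ (by simp)
    fun x y hx hy => by rw [map_add]; exact add_mem hx hy
  rintro ⟨z, hz⟩ x hx
  rw [Module.End.mem_maxGenEigenspace] at hx
  obtain ⟨k, hk⟩ := hx
  refine Submodule.mem_iSup_of_mem ⟨(starRingEnd ℂ) z, by simpa using hz⟩ ?_
  rw [Module.End.mem_maxGenEigenspace]
  exact ⟨k, by rw [← tensorConj_sub_smul_pow, hk, map_zero]⟩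

lemma tensorRe_mem {T : Module.End ℝ V} {S : Set ℝ} {x : ℂ ⊗[ℝ] V}
    (hx : x ∈ complexSpectralSubspace T S) : tensorRe V x ∈ spectralSubspace T S := by
  rw [mem_spectralSubspace, one_tmul_tensorRe]
  exact Submodule.smul_mem _ _ (add_mem hx (tensorConj_mem hx))

lemma stableSubspace_sup_unstableSubspace [FiniteDimensional ℝ V] {T : Module.End ℝ V}
    (hT : IsHyperbolic T) : stableSubspace T ⊔ unstableSubspace T = ⊤ := by
  have h1 : complexSpectralSubspace T (Iio 1) ⊔ complexSpectralSubspace T (Ioi 1) = ⊤ := by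
    rw [eq_top_iff, ← Module.End.iSup_maxGenEigenspace_eq_top (T.baseChange ℂ), iSup_le_iff]
    intro z
    rcases lt_trichotomy ‖z‖ 1 with h | h | h
    · exact le_sup_of_le_left (le_iSup_of_le (⟨z, h⟩ : {z : ℂ // ‖z‖ ∈ Iio (1 : ℝ)}) le_rfl)
    · have h2 : ¬ Module.End.HasEigenvalue (T.baseChange ℂ : Module.End ℂ (ℂ ⊗[ℝ] V)) z :=
        fun h3 => hT z h3 h
      have h3 : Module.End.eigenspace (T.baseChange ℂ : Module.End ℂ (ℂ ⊗[ℝ] V)) z = ⊥ := by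
        rwa [Module.End.hasEigenvalue_iff, not_not] at h2
      have h4 : Function.Injective (T.baseChange ℂ - z • (1 : Module.End ℂ (ℂ ⊗[ℝ] V))) := by
        rw [← LinearMap.ker_eq_bot, ← h3, Module.End.eigenspace_def]
      intro x hx
      rw [Module.End.mem_maxGenEigenspace] at hx
      obtain ⟨k, hk⟩ := hx
      rw [Module.End.pow_apply] at hk
      have : x = 0 := h4.iterate k (by rw [hk, ← Module.End.pow_apply, map_zero])
      rw [this]
      exact zero_mem _
    · exact le_sup_of_le_right (le_iSup_of_le (⟨z, h⟩ : {z : ℂ // ‖z‖ ∈ Ioi (1 : ℝ)}) le_rfl)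
  rw [eq_top_iff]
  intro v _
  obtain ⟨a, ha, b, hb, hab⟩ := Submodule.mem_sup.1 (h1 ▸ Submodule.mem_top :
    (1 : ℂ) ⊗ₜ[ℝ] v ∈ complexSpectralSubspace T (Iio 1) ⊔ complexSpectralSubspace T (Ioi 1))
  have h2 : v = tensorRe V a + tensorRe V b := by
    rw [← map_add, hab]; simp [tensorRe]
  rw [h2]
  exact Submodule.add_mem_sup (tensorRe_mem ha) (tensorRe_mem hb)

/-- The subspace of the vectors whose iterates under `T` tend to zero. -/
def contractedSubspace (T : Module.End ℝ V) : Submodule ℝ V where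
  carrier := {v | ∀ φ : Module.Dual ℝ V, Tendsto (fun n : ℕ => φ ((T ^ n) v)) atTop (𝓝 0)}
  add_mem' hv hw φ := by simpa using (hv φ).add (hw φ)
  zero_mem' φ := by simp
  smul_mem' a v hv φ := by simpa using (hv φ).const_mul a

lemma exists_norm_dual_pow_le {W : Type*} [AddCommGroup W] [Module ℂ W] (T : Module.End ℂ W) {z : ℂ}
    {r : ℝ} (hr : ‖z‖ < r) (f : Module.Dual ℂ W) (k : ℕ) (w : W)
    (hw : ((T - z • (1 : Module.End ℂ W)) ^ k) w = 0) :
    ∃ C : ℝ, ∀ n : ℕ, ‖f ((T ^ n) w)‖ ≤ C * r ^ n := by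
  have hr0 : 0 < r := (norm_nonneg z).trans_lt hr
  induction k generalizing w with
  | zero =>
    rw [pow_zero, Module.End.one_apply] at hw
    exact ⟨0, by simp [hw]⟩
  | succ k ih =>
    rw [pow_succ, Module.End.mul_apply] at hw
    obtain ⟨C', hC'⟩ := ih _ hw
    refine ⟨max ‖f w‖ (C' / (r - ‖z‖)), fun n => ?_⟩
    induction n with
    | zero => simp
    | succ n ihn =>
      set C := max ‖f w‖ (C' / (r - ‖z‖))
      -- The sequence `aₙ = f (Tⁿ w)` obeys `aₙ₊₁ = z aₙ + bₙ` with `|bₙ| ≤ C' rⁿ`; the bound `C rⁿ`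
      -- propagates exactly when `|z| C + C' ≤ r C`.
      have h1 : C' ≤ C * (r - ‖z‖) := (div_le_iff₀ (by linarith)).1 (le_max_right _ _)
      have h2 : f ((T ^ (n + 1)) w) =
          z * f ((T ^ n) w) + f ((T ^ n) ((T - z • (1 : Module.End ℂ W)) w)) := by
        rw [pow_succ, Module.End.mul_apply]
        simp
      have h3 : 0 ≤ r ^ n := by positivity
      calc ‖f ((T ^ (n + 1)) w)‖ ≤ ‖z‖ * (C * r ^ n) + C' * r ^ n := by
            rw [h2]
            refine (norm_add_le _ _).trans (add_le_add ?_ (hC' n))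
            rw [norm_mul]
            exact mul_le_mul_of_nonneg_left ihn (norm_nonneg _)
        _ ≤ ‖z‖ * (C * r ^ n) + C * (r - ‖z‖) * r ^ n := by gcongr
        _ = C * r ^ (n + 1) := by ring

lemma stableSubspace_le_contractedSubspace (T : Module.End ℝ V) :
    stableSubspace T ≤ contractedSubspace T := by
  intro v hv φ
  have key : ∀ (f : Module.Dual ℂ (ℂ ⊗[ℝ] V)), ∀ x ∈ complexSpectralSubspace T (Iio 1),
      Tendsto (fun n : ℕ => f (((T.baseChange ℂ) ^ n) x)) atTop (𝓝 0) := by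
    intro f x hx
    refine Submodule.iSup_induction _ (motive := fun x => Tendsto
      (fun n : ℕ => f (((T.baseChange ℂ) ^ n) x)) atTop (𝓝 0)) hx ?_ (by simp)
      fun x y hx hy => by simpa using hx.add hy
    rintro ⟨z, hz⟩ x hx
    rw [Module.End.mem_maxGenEigenspace] at hx
    obtain ⟨k, hk⟩ := hx
    obtain ⟨r, hzr, hr⟩ := exists_between (show ‖z‖ < 1 from hz)
    obtain ⟨C, hC⟩ := exists_norm_dual_pow_le _ hzr f k x hk
    refine squeeze_zero_norm hC ?_
    simpa using (tendsto_pow_atTop_nhds_zero_of_lt_one ((norm_nonneg z).trans hzr.le) hr).const_mul C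
  let f : Module.Dual ℂ (ℂ ⊗[ℝ] V) :=
    φ.baseChange ℂ
  have h1 := (Complex.continuous_re.tendsto 0).comp (key f _ (mem_spectralSubspace.1 hv))
  refine (h1.congr fun n => ?_)
  simp [f, ← LinearMap.baseChange_pow]

lemma unstableSubspace_le_contractedSubspace {T S : Module.End ℝ V} (hST : S * T = 1)
    (hTS : T * S = 1) : unstableSubspace T ≤ contractedSubspace S := by
  refine le_trans ?_ (stableSubspace_le_contractedSubspace S)
  intro v hv
  refine mem_spectralSubspace.2 (Submodule.iSup_induction _
    (motive := fun x => x ∈ complexSpectralSubspace S (Iio 1)) (mem_spectralSubspace.1 hv) ?_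
    (zero_mem _) fun _ _ => add_mem)
  rintro ⟨z, hz⟩ x hx
  have hz1 : 1 < ‖z‖ := hz
  have hz0 : z ≠ 0 := norm_pos_iff.1 (one_pos.trans hz1)
  rw [Module.End.mem_maxGenEigenspace] at hx
  obtain ⟨k, hk⟩ := hx
  refine Submodule.mem_iSup_of_mem ⟨z⁻¹, ?_⟩ ?_
  · rw [norm_inv]; exact inv_lt_one_of_one_lt₀ hz1
  rw [Module.End.mem_maxGenEigenspace]
  refine ⟨k, ?_⟩
  have e1 : S.baseChange ℂ * T.baseChange ℂ = (1 : Module.End ℂ (ℂ ⊗[ℝ] V)) := by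
    rw [← LinearMap.baseChange_mul, hST]; ext; simp
  have e2 : T.baseChange ℂ * S.baseChange ℂ = (1 : Module.End ℂ (ℂ ⊗[ℝ] V)) := by
    rw [← LinearMap.baseChange_mul, hTS]; ext; simp
  -- As `S` inverts `T`, `S - z⁻¹ = -z⁻¹ S (T - z)` with commuting factors, so generalized
  -- eigenvectors of `T` for `z` are those of `S` for `z⁻¹`.
  have e3 : S.baseChange ℂ - z⁻¹ • (1 : Module.End ℂ (ℂ ⊗[ℝ] V)) =
      (-z⁻¹ • S.baseChange ℂ) * (T.baseChange ℂ - z • (1 : Module.End ℂ (ℂ ⊗[ℝ] V))) := by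
    refine LinearMap.ext fun y => ?_
    have e : S.baseChange ℂ (T.baseChange ℂ y) = y := LinearMap.congr_fun e1 y
    simp only [Module.End.mul_apply, LinearMap.sub_apply, LinearMap.smul_apply,
      Module.End.one_apply, map_sub, map_smul, e, smul_smul]
    rw [neg_smul, mul_neg, mul_inv_cancel₀ hz0, neg_smul, one_smul]
    abel
  have e4 : Commute (-z⁻¹ • S.baseChange ℂ) (T.baseChange ℂ - z • (1 : Module.End ℂ (ℂ ⊗[ℝ] V))) :=
    ((show Commute (S.baseChange ℂ) (T.baseChange ℂ) from e1.trans e2.symm).sub_right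
      ((Commute.one_right _).smul_right z)).smul_left _
  rw [e3, e4.mul_pow, Module.End.mul_apply, hk, map_zero]

end Complexification

/-! ### Contracted subspaces, equivariant bilinear maps and domination. -/

section Contraction

variable {V : Type*} [NormedAddCommGroup V] [NormedSpace ℝ V] [FiniteDimensional ℝ V]

/-- Coordinatewise and norm convergence agree in finite dimension. The definition by functionals
mentions no norm, so the norm can be chosen later to suit a domination. -/
lemma mem_contractedSubspace {T : Module.End ℝ V} {v : V} :
    v ∈ contractedSubspace T ↔ Tendsto (fun n : ℕ => (T ^ n) v) atTop (𝓝 0) := by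
  constructor
  · intro h
    let b := Module.finBasis ℝ V
    have h1 : Tendsto (fun n : ℕ => ∑ i, b.coord i ((T ^ n) v) • b i) atTop
        (𝓝 (∑ i, (0 : ℝ) • b i)) :=
      tendsto_finsetSum _ fun i _ => (h (b.coord i)).smul_const _
    simpa using h1
  · intro h φ
    simpa [Function.comp_def] using (φ.continuous_of_finiteDimensional.tendsto 0).comp h

/-- By Banach–Steinhaus the powers of `T` are uniformly bounded on its contracted subspace; if `v`
is also contracted by `S`, then `v = Tⁿ Sⁿ v` is bounded by a constant times `‖Sⁿ v‖ → 0`. -/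
lemma disjoint_contractedSubspace {T S : Module.End ℝ V} (hST : S * T = 1) (hTS : T * S = 1) :
    Disjoint (contractedSubspace T) (contractedSubspace S) := by
  rw [Submodule.disjoint_def]
  intro v hv hv'
  have hinv : ∀ n : ℕ, (S ^ n) v ∈ contractedSubspace T := by
    intro n
    rw [mem_contractedSubspace] at hv ⊢
    have h1 := ((S ^ n).continuous_of_finiteDimensional.tendsto 0).comp hv
    rw [map_zero] at h1
    refine h1.congr fun m => ?_
    have hc : Commute (S ^ n) (T ^ m) := (show Commute S T from hST.trans hTS.symm).pow_pow n m
    rw [Function.comp_apply, ← Module.End.mul_apply, hc.eq, Module.End.mul_apply]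
  let g : ℕ → contractedSubspace T →L[ℝ] V := fun n =>
    LinearMap.toContinuousLinearMap ((T ^ n) ∘ₗ (contractedSubspace T).subtype)
  obtain ⟨C, hC⟩ := banach_steinhaus (g := g) fun x => by
    obtain ⟨C, hC⟩ := (mem_contractedSubspace.1 x.2).norm.bddAbove_range
    exact ⟨C, fun n => hC ⟨n, rfl⟩⟩
  have h1 : ∀ n : ℕ, ‖v‖ ≤ C * ‖(S ^ n) v‖ := by
    intro n
    have h2 := (g n).le_of_opNorm_le (hC n) ⟨_, hinv n⟩
    have h3 : g n ⟨_, hinv n⟩ = v := by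
      change (T ^ n) ((S ^ n) v) = v
      rw [← Module.End.mul_apply, ← (show Commute T S from hTS.trans hST.symm).mul_pow, hTS, one_pow,
        Module.End.one_apply]
    rwa [h3] at h2
  have h4 := (mem_contractedSubspace.1 hv').norm.const_mul C
  rw [norm_zero, mul_zero] at h4
  exact norm_le_zero_iff.1 (ge_of_tendsto' h4 h1)

/-- The spectral subspaces span everything and lie in disjoint contracted subspaces, so both
inclusions are equalities. -/
lemma stableSubspace_eq_and_unstableSubspace_eq {T S : Module.End ℝ V} (hT : IsHyperbolic T)
    (hST : S * T = 1) (hTS : T * S = 1) :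
    stableSubspace T = contractedSubspace T ∧ unstableSubspace T = contractedSubspace S := by
  have h1 := stableSubspace_sup_unstableSubspace hT
  have hs := stableSubspace_le_contractedSubspace T
  have hu := unstableSubspace_le_contractedSubspace hST hTS
  have hd := disjoint_contractedSubspace hST hTS
  exact ⟨eq_of_le_of_inf_le_of_le_sup hs (hd.le_bot.trans' (inf_le_inf_left _ hu) |>.trans bot_le)
      (by rw [h1]; exact le_top),
    eq_of_le_of_inf_le_of_le_sup (z := stableSubspace T) hu
      ((hd.symm.le_bot.trans' (inf_le_inf_left _ hs)).trans bot_le)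
      (by rw [sup_comm, h1]; exact le_top)⟩

lemma map_pow_bilin {T : Module.End ℝ V} {B : V →ₗ[ℝ] V →ₗ[ℝ] V}
    (hB : ∀ v w, T (B v w) = B (T v) (T w)) (n : ℕ) (v w : V) :
    (T ^ n) (B v w) = B ((T ^ n) v) ((T ^ n) w) := by
  induction n with
  | zero => simp
  | succ n ih => simp only [pow_succ', Module.End.mul_apply, ih, hB]

lemma exists_norm_bilin_le (B : V →ₗ[ℝ] V →ₗ[ℝ] V) :
    ∃ K : ℝ, 0 ≤ K ∧ ∀ v w, ‖B v w‖ ≤ K * ‖v‖ * ‖w‖ := by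
  let B' : V →L[ℝ] V →L[ℝ] V :=
    LinearMap.toContinuousLinearMap (LinearMap.toContinuousLinearMap.toLinearMap ∘ₗ B)
  exact ⟨‖B'‖, norm_nonneg B', fun v w => B'.le_opNorm₂ v w⟩

lemma bilin_mem_contractedSubspace {T : Module.End ℝ V} {B : V →ₗ[ℝ] V →ₗ[ℝ] V}
    (hB : ∀ v w, T (B v w) = B (T v) (T w)) {v w : V} (hv : v ∈ contractedSubspace T)
    (hw : w ∈ contractedSubspace T) : B v w ∈ contractedSubspace T := by
  rw [mem_contractedSubspace] at *
  obtain ⟨K, -, hK⟩ := exists_norm_bilin_le B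
  refine squeeze_zero_norm (fun n => (map_pow_bilin hB n v w ▸ hK _ _)) ?_
  simpa using (hv.norm.const_mul K).mul hw.norm

/-- Write `B v w = p + q`. As `Tⁿ w` stays bounded, `Tⁿ q = B (Tⁿ v) (Tⁿ w) - Tⁿ p` is at most a
combination of `‖Tⁿ v‖` and `‖Tⁿ p‖`, which domination bounds by `rⁿ ‖Tⁿ q‖` up to a constant.
Cancelling `‖Tⁿ q‖` forces `q = 0`. -/
lemma bilin_mem_of_norm_dominated {T : Module.End ℝ V} (hT : Function.Injective T)
    {B : V →ₗ[ℝ] V →ₗ[ℝ] V} (hB : ∀ v w, T (B v w) = B (T v) (T w)) {P Q : Submodule ℝ V}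
    {C r : ℝ} (hr0 : 0 < r) (hr1 : r < 1)
    (hPQ : ∀ n : ℕ, ∀ v ∈ P, ∀ w ∈ Q,
      ‖(T ^ n) v‖ * ‖w‖ ≤ C * r ^ n * (‖v‖ * ‖(T ^ n) w‖))
    (hP : P ≤ contractedSubspace T) {v w : V} (hv : v ∈ P) (hw : w ∈ P) (hBvw : B v w ∈ P ⊔ Q) :
    B v w ∈ P := by
  obtain ⟨p, hp, q, hq, hpq⟩ := Submodule.mem_sup.1 hBvw
  suffices q = 0 by rw [← hpq, this, add_zero]; exact hp
  by_contra hq0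
  have hq1 : 0 < ‖q‖ := norm_pos_iff.2 hq0
  obtain ⟨K, hK0, hK⟩ := exists_norm_bilin_le B
  obtain ⟨M, hM⟩ := (mem_contractedSubspace.1 (hP hw)).norm.bddAbove_range
  have hM' : ∀ n : ℕ, ‖(T ^ n) w‖ ≤ M := fun n => hM ⟨n, rfl⟩
  have h1 : ∀ n : ℕ, ‖q‖ ≤ C * (‖p‖ + K * M * ‖v‖) * r ^ n := by
    intro n
    have hn : 0 < ‖(T ^ n) q‖ := by
      refine norm_pos_iff.2 fun h => hq0 ?_
      rw [Module.End.pow_apply] at h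
      exact hT.iterate n (by rw [h, ← Module.End.pow_apply, map_zero])
    have h2 : ‖(T ^ n) q‖ ≤ ‖(T ^ n) p‖ + K * ‖(T ^ n) v‖ * M := by
      have h3 : (T ^ n) q = B ((T ^ n) v) ((T ^ n) w) - (T ^ n) p := by
        rw [← map_pow_bilin hB, ← hpq, map_add, add_sub_cancel_left]
      rw [h3, add_comm]
      refine (norm_sub_le _ _).trans (add_le_add_left ((hK _ _).trans ?_) _)
      exact mul_le_mul_of_nonneg_left (hM' n) (by positivity)
    have hM0 : 0 ≤ M := (norm_nonneg _).trans (hM' 0)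
    refine le_of_mul_le_mul_right ?_ hn
    calc ‖q‖ * ‖(T ^ n) q‖ ≤ ‖q‖ * (‖(T ^ n) p‖ + K * ‖(T ^ n) v‖ * M) := by gcongr
      _ = ‖(T ^ n) p‖ * ‖q‖ + K * M * (‖(T ^ n) v‖ * ‖q‖) := by ring
      _ ≤ C * r ^ n * (‖p‖ * ‖(T ^ n) q‖) + K * M * (C * r ^ n * (‖v‖ * ‖(T ^ n) q‖)) :=
        add_le_add (hPQ n p hp q hq)
          (mul_le_mul_of_nonneg_left (hPQ n v hv q hq) (by positivity))
      _ = _ := by ring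
  have h5 := (tendsto_pow_atTop_nhds_zero_of_lt_one hr0.le hr1).const_mul
    (C * (‖p‖ + K * M * ‖v‖))
  rw [mul_zero] at h5
  exact hq1.not_ge (ge_of_tendsto' h5 h1)

end Contraction

section Domination

variable {V : Type*} [AddCommGroup V] [Module ℝ V]

lemma IsDominatedBy.bilin_mem [FiniteDimensional ℝ V] {T : Module.End ℝ V}
    (hT : Function.Injective T) {B : V →ₗ[ℝ] V →ₗ[ℝ] V}
    (hB : ∀ v w, T (B v w) = B (T v) (T w)) {P Q : Submodule ℝ V} (hPQ : IsDominatedBy T P Q)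
    (hP : P ≤ contractedSubspace T) {v w : V} (hv : v ∈ P) (hw : w ∈ P) (hBvw : B v w ∈ P ⊔ Q) :
    B v w ∈ P := by
  obtain ⟨N, hN, C, -, r, hr0, hr1, h⟩ := hPQ
  -- The norm witnessing the domination is installed as the norm of `V`.
  let nV : NormedAddCommGroup V := AddGroupNorm.toNormedAddCommGroup
    { N.toAddGroupSeminorm with eq_zero_of_map_eq_zero' := hN }
  let sV : NormedSpace ℝ V := { norm_smul_le := fun a v => (map_smul_eq_mul N a v).le }
  exact bilin_mem_of_norm_dominated hT hB hr0 hr1 h hP hv hw hBvw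

lemma IsDominatedBy.inverse {T S : Module.End ℝ V} (hST : S * T = 1) (hTS : T * S = 1)
    {P Q : Submodule ℝ V} (h : IsDominatedBy T P Q) (hP : ∀ v ∈ P, S v ∈ P)
    (hQ : ∀ v ∈ Q, S v ∈ Q) : IsDominatedBy S Q P := by
  obtain ⟨N, hN, C, hC, r, hr0, hr1, h⟩ := h
  have e : ∀ (n : ℕ) v, (T ^ n) ((S ^ n) v) = v := fun n v => by
    rw [← Module.End.mul_apply, ← (show Commute T S from hTS.trans hST.symm).mul_pow, hTS, one_pow,
      Module.End.one_apply]
  have hi : ∀ {W : Submodule ℝ V}, (∀ v ∈ W, S v ∈ W) → ∀ (n : ℕ), ∀ v ∈ W, (S ^ n) v ∈ W := by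
    intro W hW n
    induction n with
    | zero => intro v hv; simpa using hv
    | succ n ih => intro v hv; rw [pow_succ, Module.End.mul_apply]; exact ih _ (hW v hv)
  refine ⟨N, hN, C, hC, r, hr0, hr1, fun n v hv w hw => ?_⟩
  have h1 := h n _ (hi hP n w hw) _ (hi hQ n v hv)
  rw [e, e] at h1
  rw [mul_comm, mul_comm (N v)]
  exact h1

lemma mapsTo_of_inverse [FiniteDimensional ℝ V] {T S : Module.End ℝ V} (hST : S * T = 1)
    {W : Submodule ℝ V} (hW : ∀ v ∈ W, T v ∈ W) : ∀ v ∈ W, S v ∈ W := by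
  have e : ∀ v, S (T v) = v := fun v => by rw [← Module.End.mul_apply, hST, Module.End.one_apply]
  have hinj : Function.Injective (T.restrict hW) := by
    intro v w hvw
    have : T v = T w := congrArg Subtype.val hvw
    exact Subtype.ext (by rw [← e v, ← e w, this])
  intro v hv
  obtain ⟨w, hw⟩ := LinearMap.injective_iff_surjective.1 hinj ⟨v, hv⟩
  have : T w = v := congrArg Subtype.val hw
  rw [← this, e]
  exact w.2

end Domination

end NilAnosov

namespace NilAnosov

open Filter Topology Set

/-! ### Complementary sums, coset intersections and the conclusion. -/

namespace DominatedSplitting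

variable {V : Type*} [AddCommGroup V] [Module ℝ V] {T : Module.End ℝ V} (D : DominatedSplitting T)


lemma isCompl_cs_uu (h : IsCompl D.s D.u) : IsCompl D.cs D.uu := by
  have e : D.cs = D.s ⊔ D.wu := (sup_assoc _ _ _).symm
  refine ⟨?_, codisjoint_iff.2 ?_⟩
  · rw [e]
    exact D.disjoint_unstable.disjoint_sup_left_of_disjoint_sup_right h.disjoint
  · rw [e, sup_assoc]
    exact h.sup_eq_top

lemma isCompl_cu_ss (h : IsCompl D.s D.u) : IsCompl D.cu D.ss := by
  have e : D.cu = D.ws ⊔ D.u := sup_assoc _ _ _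
  refine IsCompl.symm ⟨?_, codisjoint_iff.2 ?_⟩
  · rw [e]
    exact D.disjoint_stable.disjoint_sup_right_of_disjoint_sup_left h.disjoint
  · rw [e, ← sup_assoc]
    exact h.sup_eq_top

lemma c_eq_inf (h : IsCompl D.s D.u) : D.c = D.cs ⊓ D.cu := by
  have e : D.cs = D.c ⊔ D.ss := sup_comm _ _
  have hle : D.c ≤ D.cu := le_sup_left
  rw [e, sup_inf_assoc_of_le _ hle, (D.isCompl_cu_ss h).symm.inf_eq_bot, sup_bot_eq]

end DominatedSplitting

section ProductStructure

variable {G : Type*} [Group G]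

lemma existsUnique_mem_cosets {H K L : Subgroup G} (hL : ∀ g ∈ L, ∃ h ∈ H, ∃ k ∈ K, g = h * k)
    (hHK : ∀ g ∈ H, g ∈ K → g = 1) {x y : G} (hxy : x⁻¹ * y ∈ L) :
    ∃! p : G, p ∈ (fun g => x * g) '' (H : Set G) ∩ (fun g => y * g) '' (K : Set G) := by
  obtain ⟨h, hh, k, hk, e⟩ := hL _ hxy
  refine ⟨x * h, ⟨⟨h, hh, rfl⟩, ⟨k⁻¹, inv_mem hk, ?_⟩⟩, ?_⟩
  · rw [inv_mul_eq_iff_eq_mul] at e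
    simp [e, mul_assoc]
  · rintro p ⟨⟨h', hh', rfl⟩, k', hk', e'⟩
    have e1 : y = x * (h * k) := by rw [← e]; group
    have e2 : h⁻¹ * h' = k * k' := by
      simp only [e1, mul_assoc, mul_right_inj] at e'
      simp [← e']
    have e3 := hHK (h⁻¹ * h') (mul_mem (inv_mem hh) hh') (e2 ▸ mul_mem hk hk')
    rw [inv_mul_eq_one] at e3
    simp [e3]

end ProductStructure

section LieGroup

variable {E : Type*} [NormedAddCommGroup E] [NormedSpace ℝ E] [FiniteDimensional ℝ E]
  {G : Type*} [TopologicalSpace G] [T2Space G] [ChartedSpace E G] [Group G]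
  [LieGroup 𝓘(ℝ, E) ∞ G] [IsTopologicalGroup G]

lemma integralSubgroup_eq_expSubgroup (W : Submodule ℝ E) :
    integralSubgroup (E := E) (G := G) W = expSubgroup G W := by
  have key : ∀ (v : E) (g : G), IsExp (E := E) v g ↔ g = expCurve v 1 := by
    refine fun v g => ⟨fun h => h.eq_expCurve, ?_⟩
    rintro rfl
    exact (congrArg (IsExp (E := E) · _) (one_smul ℝ v)).mp (isExp_expCurve (G := G) v 1)
  exact congrArg Subgroup.closure
    (Set.ext fun g => exists_congr fun v => and_congr_right fun _ => key v g)

lemma isSubalgebra_of_isLieSubalgebra {W : Submodule ℝ E}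
    (h : IsLieSubalgebra (E := E) (G := G) W) : IsSubalgebra G W := by
  intro v hv w hw
  have e := bracket_eq_chartBracket (E := E) (G := G) v w
  exact (congrArg (· ∈ W) e).mp (h v hv w hw)

/-- The leaf through `x` of the algebraic foliation given by `W`. -/
def expLeaf (W : Submodule ℝ E) (x : G) : Set G := (fun g => x * g) '' (expSubgroup G W : Set G)

lemma leaf_eq_expLeaf (W : Submodule ℝ E) : leaf (E := E) (G := G) W = expLeaf W := by
  funext x
  exact congrArg (fun K : Subgroup G => (fun g => x * g) '' (K : Set G))
    (integralSubgroup_eq_expSubgroup W)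

lemma chartDeriv_symm_mul (A : G ≃* G) (hA : ContMDiff 𝓘(ℝ, E) 𝓘(ℝ, E) ∞ A)
    (hA_symm : ContMDiff 𝓘(ℝ, E) 𝓘(ℝ, E) ∞ A.symm) :
    ((chartDeriv A.symm : E →L[ℝ] E) : Module.End ℝ E) * (chartDeriv A : E →L[ℝ] E) = 1 := by
  have h := chartDeriv_comp (E := E) (hA_symm 1) (hA 1) (map_one _) (map_one _)
  have e : (A.symm ∘ A : G → G) = fun g => 1 * g * 1⁻¹ := by funext g; simp
  have e1 : (chartDeriv (fun g : G => 1 * g * 1⁻¹) : E →L[ℝ] E) = ContinuousLinearMap.id ℝ E :=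
    Ad_one
  rw [e, e1] at h
  refine LinearMap.ext fun v => ?_
  exact (DFunLike.congr_fun h v).symm

lemma expLeaf_subset {W W' : Submodule ℝ E} (h : W ≤ W') (x : G) : expLeaf W x ⊆ expLeaf W' x :=
  image_mono (expSubgroup_mono h)

variable [ConnectedSpace G] [SimplyConnectedSpace G] [Group.IsNilpotent G]

lemma IsSubalgebra.hasGPS {h k : Submodule ℝ E} (hh : IsSubalgebra G h) (hk : IsSubalgebra G k)
    (hhk : IsCompl h k) : HasGPS (expLeaf h : G → Set G) (expLeaf k) := by
  refine fun x y => existsUnique_mem_cosets (L := ⊤) (fun g _ => ?_)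
    (fun g => eq_one_of_mem_expSubgroup hh hk hhk) (Subgroup.mem_top _)
  refine exists_mul_eq_of_mem_expSubgroup_sup hh hk ?_ hhk.disjoint ?_
  · rw [hhk.sup_eq_top]; exact fun _ _ _ _ => Submodule.mem_top
  · rw [hhk.sup_eq_top, expSubgroup_top]; exact Subgroup.mem_top _

/-- Inside a leaf the factorization is that of the subgroup of `h ⊔ k`. Uniqueness is inherited from
the larger `h'`, a full complement of `k`, so only `G` itself has to be simply connected. -/
lemma IsSubalgebra.hasGPSInside {h h' k l : Submodule ℝ E} (hh : IsSubalgebra G h)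
    (hh' : IsSubalgebra G h') (hk : IsSubalgebra G k) (hl : IsSubalgebra G l) (hsub : h ≤ h')
    (hsup : h ⊔ k = l) (hhk : IsCompl h' k) :
    HasGPSInside (expLeaf l : G → Set G) (expLeaf h) (expLeaf k) := by
  subst hsup
  refine ⟨expLeaf_subset le_sup_left, expLeaf_subset le_sup_right, ?_⟩
  rintro x _ ⟨g, hg, rfl⟩
  exact existsUnique_mem_cosets (L := expSubgroup G (h ⊔ k))
    (fun g hg => exists_mul_eq_of_mem_expSubgroup_sup hh hk hl (hhk.disjoint.mono_left hsub) hg)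
    (fun g hg => eq_one_of_mem_expSubgroup hh' hk hhk (expSubgroup_mono hsub hg))
    (by simpa using hg)

variable (G) in
lemma gps_of_dominatedSplitting {T S : Module.End ℝ E} (hST : S * T = 1) (hTS : T * S = 1)
    (hT : ∀ v w, T (chartBracket E G v w) = chartBracket E G (T v) (T w))
    (hyp : IsHyperbolic T) (D : DominatedSplitting T) (hcs : IsSubalgebra G D.cs)
    (hcu : IsSubalgebra G D.cu) :
    HasGPS (expLeaf D.cs : G → Set G) (expLeaf D.uu) ∧
    HasGPS (expLeaf D.cu : G → Set G) (expLeaf D.ss) ∧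
    HasGPSInside (expLeaf D.cu : G → Set G) (expLeaf D.c) (expLeaf D.uu) ∧
    HasGPSInside (expLeaf D.cs : G → Set G) (expLeaf D.c) (expLeaf D.ss) ∧
    HasGPS (expLeaf D.s : G → Set G) (expLeaf D.u) := by
  obtain ⟨es, eu⟩ := stableSubspace_eq_and_unstableSubspace_eq hyp hST hTS
  have hs : D.s = contractedSubspace T := D.sup_stable.trans es
  have hu : D.u = contractedSubspace S := D.sup_unstable.trans eu
  have hsu : IsCompl D.s D.u := by
    refine ⟨?_, codisjoint_iff.2 ?_⟩
    · rw [hs, hu]; exact disjoint_contractedSubspace hST hTS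
    · rw [hs, hu, ← es, ← eu]; exact stableSubspace_sup_unstableSubspace hyp
  have eST : ∀ v, S (T v) = v := fun v => by rw [← Module.End.mul_apply, hST, Module.End.one_apply]
  have eTS : ∀ v, T (S v) = v := fun v => by rw [← Module.End.mul_apply, hTS, Module.End.one_apply]
  let B : E →ₗ[ℝ] E →ₗ[ℝ] E := (ContinuousLinearMap.coeLM ℝ) ∘ₗ (chartBracket E G : E →ₗ[ℝ] E →L[ℝ] E)
  have hTB : ∀ v w, T (B v w) = B (T v) (T w) := hT
  have hSB : ∀ v w, S (B v w) = B (S v) (S w) := fun v w => by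
    conv_lhs => rw [← eTS v, ← eTS w, ← hTB, eST]
  have as : IsSubalgebra G D.s := fun v hv w hw => by
    rw [hs] at *
    exact bilin_mem_contractedSubspace hTB hv hw
  have au : IsSubalgebra G D.u := fun v hv w hw => by
    rw [hu] at *
    exact bilin_mem_contractedSubspace hSB hv hw
  have ass : IsSubalgebra G D.ss := fun v hv w hw =>
    D.dominated_ss_ws.bilin_mem (Function.LeftInverse.injective eST) hTB (hs ▸ le_sup_left) hv hw
      (as v (Submodule.mem_sup_left hv) w (Submodule.mem_sup_left hw))
  -- Under the inverse `S` the domination reverses, and `uu` plays the role that `ss` has for `T`.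
  have auu : IsSubalgebra G D.uu := fun v hv w hw =>
    (D.dominated_wu_uu.inverse hST hTS (mapsTo_of_inverse hST D.map_wu)
      (mapsTo_of_inverse hST D.map_uu)).bilin_mem (Function.LeftInverse.injective eTS) hSB
      (hu ▸ le_sup_right) hv hw
      (by rw [sup_comm]; exact au v (Submodule.mem_sup_right hv) w (Submodule.mem_sup_right hw))
  have ac : IsSubalgebra G D.c := by
    rw [D.c_eq_inf hsu]
    exact fun v hv w hw => ⟨hcs v hv.1 w hw.1, hcu v hv.2 w hw.2⟩
  exact ⟨hcs.hasGPS auu (D.isCompl_cs_uu hsu), hcu.hasGPS ass (D.isCompl_cu_ss hsu),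
    ac.hasGPSInside hcs auu hcu le_sup_right rfl (D.isCompl_cs_uu hsu),
    ac.hasGPSInside hcu ass hcs le_sup_left (sup_comm _ _) (D.isCompl_cu_ss hsu),
    as.hasGPS au hsu⟩

end LieGroup

end NilAnosov

end

theorem mainTheorem8
    {E : Type*} [NormedAddCommGroup E] [NormedSpace ℝ E] [FiniteDimensional ℝ E]
    {G : Type*} [TopologicalSpace G] [T2Space G] [SecondCountableTopology G]
    [ChartedSpace E G] [Group G] [LieGroup 𝓘(ℝ, E) ∞ G]
    [ConnectedSpace G] [SimplyConnectedSpace G] [Group.IsNilpotent G]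
    (Γ : Subgroup G) [DiscreteTopology Γ] [CompactSpace (G ⧸ Γ)]
    (A : G ≃* G) (hA : ContMDiff 𝓘(ℝ, E) 𝓘(ℝ, E) ∞ A)
    (hA_symm : ContMDiff 𝓘(ℝ, E) 𝓘(ℝ, E) ∞ A.symm)
    (hAΓ : Γ.map A.toMonoidHom = Γ)
    (hyp : NilAnosov.IsHyperbolic (NilAnosov.lieDifferential (E := E) A))
    (D : NilAnosov.DominatedSplitting (NilAnosov.lieDifferential (E := E) A))
    (hcs : NilAnosov.IsLieSubalgebra D.cs) (hcu : NilAnosov.IsLieSubalgebra D.cu) :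
    NilAnosov.HasGPS (NilAnosov.leaf D.cs) (NilAnosov.leaf D.uu) ∧
    NilAnosov.HasGPS (NilAnosov.leaf D.cu) (NilAnosov.leaf D.ss) ∧
    NilAnosov.HasGPSInside (NilAnosov.leaf D.cu) (NilAnosov.leaf D.c) (NilAnosov.leaf D.uu) ∧
    NilAnosov.HasGPSInside (NilAnosov.leaf D.cs) (NilAnosov.leaf D.c) (NilAnosov.leaf D.ss) ∧
    NilAnosov.HasGPS (NilAnosov.leaf D.s) (NilAnosov.leaf D.u) := by
  have : IsTopologicalGroup G := topologicalGroup_of_lieGroup 𝓘(ℝ, E) ∞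
  let T : Module.End ℝ E := NilAnosov.lieDifferential (E := E) A
  have hT : T = (NilAnosov.chartDeriv A : E →L[ℝ] E) :=
    LinearMap.ext fun v => NilAnosov.mfderiv_one_eq_chartDeriv (hA 1) (map_one A) v
  have h := NilAnosov.gps_of_dominatedSplitting G (T := T)
    (S := (NilAnosov.chartDeriv A.symm : E →L[ℝ] E))
    (by rw [hT]; exact NilAnosov.chartDeriv_symm_mul A hA hA_symm)
    (by rw [hT]; exact NilAnosov.chartDeriv_symm_mul A.symm hA_symm hA)
    (fun v w => by rw [hT]; exact NilAnosov.chartDeriv_chartBracket hA (map_mul A) v w) hyp D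
    (NilAnosov.isSubalgebra_of_isLieSubalgebra hcs) (NilAnosov.isSubalgebra_of_isLieSubalgebra hcu)
  simp only [← NilAnosov.leaf_eq_expLeaf] at h
  exact h
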